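/- Let $\Psi=\sqrt{(1+\sqrt5)/2}$ and $s=1/\Psi$, so that $s^2+s^4=1$. The large Ammann A2 tile is the L-shaped hexagon with corners, in cyclic order, $(0,0),(1,0),(1,s^3),(s^2,s^3),(s^2,s),(0,s)$, and the small tile is its copy scaled by $s$. The substitution replaces a small tile by the large tile (scaled by $s$) that occupies the same place, and cuts a large tile into a large and a small tile, both scaled by $s$: if the large tile is the hexagon above, the pieces are the images of the large prototile under $(x,y)\mapsto (sy,\,s-sx)$ and of the small prototile under $(x,y)\mapsto(1-sx,\,sy)$. Let A2-1 be a single small tile, and for $k\ge1$ let A2-$(k+1)$ be obtained from A2-$k$ by substituting every tile (so A2-2 is a single large tile). The graph of A2-$k$ has as vertices all corners of all tiles and as edges the sides of the tiles, where a side with corners of other tiles in its interior is divided by them into several edges; that is, two distinct vertices are adjacent if and only if the segment between them is contained in a side of some tile and has no vertex in its interior. Let $V(k)$ be the number of vertices, $T(k)$ the sum of the degrees of all vertices of this graph, and $F(n)$ the $n$th Fibonacci number ($F(1)=F(2)=1$). **Theorem.** For every $k\ge 7$, $$V(k)=\begin{cases} 1+\frac{F(k/2)}{2}+F\left(\frac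 k2+1\right)+2F\left(\frac k2-1\right)-\frac{F(k/2-3)}{2}+\left(\frac{31}{2}+\frac{69}{2\sqrt5}\right)\left(\frac{1+\sqrt5}{2}\right)^{k-7}+\left(\frac{31}{2}-\frac{69}{2\sqrt5}\right)\left(\frac{1-\sqrt5}{2}\right)^{k-7}, & k\text{ even},\\[4pt] 1+2F\left(\frac{k+1}{2}\right)+F\left(\frac{k-1}{2}\right)+\left(\frac{31}{2}+\frac{69}{2\sqrt5}\right)\left(\frac{1+\sqrt5}{2}\right)^{k-7}+\left(\frac{31}{2}-\frac{69}{2\sqrt5}\right)\left(\frac{1-\sqrt5}{2}\right)^{k-7}, & k\text{ odd}, \end{cases}$$ $$T(k)=\begin{cases} F\left(\frac k2\right)+2F\left(\frac k2+1\right)+4F\left(\frac k2-1\right)-F\left(\frac k2-3\right)+\left(44+\frac{98}{\sqrt5}\right)\left(\frac{1+\sqrt5}{2}\right)^{k-7}+\left(44-\frac{98}{\sqrt5}\right)\left(\frac{1-\sqrt5}{2}\right)^{k-7}, & k\text{ even},\\[4pt] 4F\left(\frac{k+1}{2}\right)+2F\left(\frac{k-1}{2}\right)+\left(44+\frac{98}{\sqrt5}\right)\left(\frac{1+\sqrt5}{2}\right)^{k-7}+\left(44-\frac{98}{\sqrt5}\right)\left(\frac{1-\sqrt5}{2}\right)^{k-7},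 & k\text{ odd}. \end{cases}$$ The average degree of the graph of A2-$k$ is $T(k)/V(k)$, and $$\lim_{k\to\infty}\frac{T(k)}{V(k)}=\frac{44+\frac{98}{\sqrt5}}{\frac{31}{2}+\frac{69}{2\sqrt5}}\approx 2.8396425434090715,$$ where the absolute error of the decimal value is less than $10^{-15}$. -/

import Mathlib

open Filter Topology

/-- The scaling factor `1/Ψ`, where `Ψ` is the square root of the golden ratio `(1 + √5)/2`. -/
noncomputable def invPsi : ℝ := 1 / Real.sqrt ((1 + Real.sqrt 5) / 2)

/-- The six corners, in cyclic order, of the large Ammann A2 hexagon, normalized so that its longest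
side has length `1`. Writing `s` for `invPsi`, its sides have, in cyclic order, the lengths
`1, s ^ 3, s ^ 4, s ^ 5, s ^ 2, s` (recall `s ^ 2 + s ^ 4 = 1`), and the corner with index `3` is the
reentrant one. -/
noncomputable def largeHexagon : Fin 6 → ℝ × ℝ :=
  ![(0, 0), (1, 0), (1, invPsi ^ 3), (invPsi ^ 2, invPsi ^ 3), (invPsi ^ 2, invPsi), (0, invPsi)]

/-- The two kinds of Ammann A2 tiles. -/
inductive TileKind
  | small
  | large

/-- The corners of the two prototiles: the small hexagon is the large one scaled by `1/Ψ`. -/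
noncomputable def TileKind.hexagon : TileKind → Fin 6 → ℝ × ℝ
  | .small => fun i => invPsi • largeHexagon i
  | .large => largeHexagon

/-- A tile: its kind, together with the map of the plane that carries the prototile of that kind
to the tile. (All the maps arising below are similarities.) -/
structure Tile where
  kind : TileKind
  place : ℝ × ℝ → ℝ × ℝ

/-- The `i`-th corner of a tile. -/
noncomputable def Tile.corner (t : Tile) (i : Fin 6) : ℝ × ℝ := t.place (t.kind.hexagon i)

/-- The `i`-th side of a tile, a closed straight segment between cyclically consecutive corners. -/
def Tile.side (t : Tile) (i : Fin 6) : Set (ℝ × ℝ) := segment ℝ (t.corner i) (t.corner (i + 1))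

/-- The Ammann A2 substitution rule on a single tile, all new tiles being scaled by `1/Ψ`. A small
tile becomes the large tile that occupies the same place. A large tile is cut into a large tile, which
is scaled by `1/Ψ` and rotated clockwise by 90 degrees, and a small tile, which is scaled by `1/Ψ` and
reflected in a vertical line. -/
noncomputable def Tile.substitute (t : Tile) : List Tile :=
  match t.kind with
  | .small => [⟨.large, fun p => t.place (invPsi • p)⟩]
  | .large =>
      [⟨.large, fun p => t.place (invPsi * p.2, invPsi - invPsi * p.1)⟩,
       ⟨.small, fun p => t.place (1 - invPsi * p.1, invPsi * p.2)⟩]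

/-- One step of the substitution: every tile of the list is substituted. -/
noncomputable def substitutionStep (P : List Tile) : List Tile := P.flatMap Tile.substitute

/-- The tiling A2-`k`, for `k ≥ 1`: A2-1 is a single small tile, A2-2 a single large tile, and each
further generation is obtained from the preceding one by one step of the substitution. -/
noncomputable def ammannA2 (k : ℕ) : List Tile := substitutionStep^[k - 1] [⟨.small, id⟩]

/-- The set of all corners of all tiles. -/
noncomputable def corners (P : List Tile) : Finset (ℝ × ℝ) :=
  (P.flatMap fun t => List.ofFn t.corner).toFinset

/-- The graph of a tiling: the vertices are the corners of the tiles, the edges are the sides of the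
tiles, where a side that has corners of further tiles in its interior is divided by them into several
edges. So two vertices are adjacent when the segment between them is part of a side of a tile and
there is no vertex strictly between them. -/
def tilingGraph (P : List Tile) : SimpleGraph (corners P) where
  Adj p q := p ≠ q ∧
    (∃ t ∈ P, ∃ i : Fin 6, segment ℝ (p : ℝ × ℝ) (q : ℝ × ℝ) ⊆ t.side i) ∧
    ∀ r ∈ corners P, r ∉ openSegment ℝ (p : ℝ × ℝ) (q : ℝ × ℝ)
  symm := ⟨fun p q h => by
    rw [segment_symm ℝ (q : ℝ × ℝ), openSegment_symm ℝ (q : ℝ × ℝ)]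
    exact ⟨h.1.symm, h.2⟩⟩
  loopless := ⟨fun _ h => h.1 rfl⟩

open Classical in
/-- The sum of the degrees of all vertices of a finite graph. -/
noncomputable def totalDegree {α : Type*} [Fintype α] (G : SimpleGraph α) : ℕ := ∑ v, G.degree v

/-- The average degree of a finite graph. -/
noncomputable def averageDegree {α : Type*} [Fintype α] (G : SimpleGraph α) : ℝ :=
  (totalDegree G : ℝ) / (Fintype.card α : ℝ)

/-- The graph of the tiling A2-`k`. -/
noncomputable def a2Graph (k : ℕ) : SimpleGraph (corners (ammannA2 k)) := tilingGraph (ammannA2 k)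

/-- The number of vertices of the graph of A2-`k`. -/
noncomputable def a2V (k : ℕ) : ℕ := Fintype.card (corners (ammannA2 k))

/-- The total degree of the graph of A2-`k`. -/
noncomputable def a2T (k : ℕ) : ℕ := totalDegree (a2Graph k)

/-! Write `s` for `invPsi`. One substitution cuts the large prototile into a large and a small tile,
and the small one needs one more step to become large. So each dissection of the large prototile is
a similar copy of the preceding one, glued to a similar copy of the one before that (`verts_succ`,
`sides_succ`). Without overlap, vertices and degrees would obey the Fibonacci recursion; the
correction is what the two copies share along the staircase of three segments that separates them.

The sides of the hexagon have the lengths `s ^ j`, `j = 0, ..., 5`. In step `n`, the side of length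
`s ^ j` carries a scaled copy of the vertices that the bottom side has in step `n - j` (truncated
subtraction). The bottom side itself splits at abscissa `s ^ 4` into scaled copies of its own
earlier states (`bottom_succ`), so its vertices are counted by a Fibonacci number at about half the
index (`ncard_bottom`). The same delays show that both copies put the same vertices on the staircase
(`junction_mem_largeVerts`, `junction_mem_smallVerts`). The exception is the reentrant corner of the
hexagon: it is a corner of the small piece, but lies inside a side of the large piece, and in the
first three steps it has to be added there by hand (`topPoint`).

If the staircase has `C` vertices, gluing removes `C` vertices and, since the shared graph is a
path, `2 * C - 2` darts, that is, ordered pairs of adjacent vertices (`ncard_verts_succ`,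
`ncard_darts_succ`). Because `C` is built from Fibonacci numbers at half the index, the
inhomogeneous recursions have the explicit particular solutions `1 + boundaryTerm` and `2 *
boundaryTerm`; the rest obeys the Fibonacci recursion, is fixed by two initial values and is
rewritten by Binet's formula. `boundaryTerm` is negligible against the powers of the golden ratio,
so the average degree tends to the quotient of the leading coefficients. -/

/-! ### Darts of a graph drawn in the plane: similarity, gluing, subdivision. -/

/-- The ordered pairs of adjacent vertices for the vertex set `X` and the family of sides `S`. -/
def darts (X : Set (ℝ × ℝ)) (S : Set (Set (ℝ × ℝ))) : Set ((ℝ × ℝ) × (ℝ × ℝ)) :=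
  {d | d.1 ∈ X ∧ d.2 ∈ X ∧ d.1 ≠ d.2 ∧ (∃ t ∈ S, segment ℝ d.1 d.2 ⊆ t) ∧
    ∀ r ∈ X, r ∉ openSegment ℝ d.1 d.2}

theorem darts_subset_prod (X : Set (ℝ × ℝ)) (S : Set (Set (ℝ × ℝ))) : darts X S ⊆ X ×ˢ X :=
  fun _ h => ⟨h.1, h.2.1⟩

theorem finite_darts {X : Set (ℝ × ℝ)} (hX : X.Finite) (S : Set (Set (ℝ × ℝ))) :
    (darts X S).Finite :=
  (hX.prod hX).subset (darts_subset_prod X S)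

theorem mk_mem_darts_comm {X : Set (ℝ × ℝ)} {S : Set (Set (ℝ × ℝ))} {p q : ℝ × ℝ} :
    (p, q) ∈ darts X S ↔ (q, p) ∈ darts X S := by
  simp only [darts, Set.mem_ofPred_eq]
  rw [segment_symm ℝ p q, openSegment_symm ℝ p q, ne_comm]
  tauto

theorem darts_image (f : ℝ × ℝ →ᵃ[ℝ] ℝ × ℝ) (hf : Function.Injective f) (X : Set (ℝ × ℝ))
    (S : Set (Set (ℝ × ℝ))) :
    darts (f '' X) (Set.image f '' S) = Prod.map f f '' darts X S := by
  ext ⟨p, q⟩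
  constructor
  · rintro ⟨⟨p, hp, rfl⟩, ⟨q, hq, rfl⟩, hne, ⟨_, ⟨t, ht, rfl⟩, hst⟩, ho⟩
    refine ⟨(p, q), ⟨hp, hq, fun h => hne (by simpa using congrArg f h), ⟨t, ht, ?_⟩, ?_⟩, rfl⟩
    · simp only at hst ⊢
      rw [← image_segment] at hst
      exact (Set.image_subset_image_iff hf).1 hst
    · intro r hr hro
      refine ho (f r) ⟨r, hr, rfl⟩ ?_
      simp only
      rw [← image_openSegment]
      exact ⟨r, hro, rfl⟩
  · rintro ⟨⟨p', q'⟩, ⟨hp, hq, hne, ⟨t, ht, hst⟩, ho⟩, h⟩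
    simp only [Prod.map, Prod.mk.injEq] at h
    obtain ⟨rfl, rfl⟩ := h
    refine ⟨⟨p', hp, rfl⟩, ⟨q', hq, rfl⟩, fun h => hne (hf h), ⟨_, ⟨t, ht, rfl⟩, ?_⟩, ?_⟩
    · simp only
      rw [← image_segment]
      exact Set.image_mono hst
    · rintro _ ⟨r, hr, rfl⟩
      simp only
      rw [← image_openSegment]
      rintro ⟨r', hr', h⟩
      exact ho r hr (hf h ▸ hr')

theorem ncard_darts_image (f : ℝ × ℝ →ᵃ[ℝ] ℝ × ℝ) (hf : Function.Injective f) (X : Set (ℝ × ℝ))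
    (S : Set (Set (ℝ × ℝ))) :
    (darts (f '' X) (Set.image f '' S)).ncard = (darts X S).ncard := by
  rw [darts_image f hf, Set.ncard_image_of_injective _ (hf.prodMap hf)]

/-- Two graphs drawn in regions `K₁` and `K₂` whose vertices agree on `K₁ ∩ K₂` can be glued. -/
theorem darts_union {X₁ X₂ K₁ K₂ : Set (ℝ × ℝ)} {S₁ S₂ : Set (Set (ℝ × ℝ))}
    (hS₁ : ∀ t ∈ S₁, t ⊆ K₁) (hS₂ : ∀ t ∈ S₂, t ⊆ K₂)
    (h₁₂ : X₁ ∩ K₂ ⊆ X₂) (h₂₁ : X₂ ∩ K₁ ⊆ X₁) :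
    darts (X₁ ∪ X₂) (S₁ ∪ S₂) = darts X₁ S₁ ∪ darts X₂ S₂ := by
  ext ⟨p, q⟩
  constructor
  · rintro ⟨hp, hq, hne, ⟨t, ht | ht, hst⟩, ho⟩
    · have hK : segment ℝ p q ⊆ K₁ := hst.trans (hS₁ t ht)
      refine Or.inl ⟨?_, ?_, hne, ⟨t, ht, hst⟩, fun r hr => ho r (Or.inl hr)⟩
      · exact hp.elim id fun h => h₂₁ ⟨h, hK (left_mem_segment ℝ p q)⟩
      · exact hq.elim id fun h => h₂₁ ⟨h, hK (right_mem_segment ℝ p q)⟩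
    · have hK : segment ℝ p q ⊆ K₂ := hst.trans (hS₂ t ht)
      refine Or.inr ⟨?_, ?_, hne, ⟨t, ht, hst⟩, fun r hr => ho r (Or.inr hr)⟩
      · exact hp.elim (fun h => h₁₂ ⟨h, hK (left_mem_segment ℝ p q)⟩) id
      · exact hq.elim (fun h => h₁₂ ⟨h, hK (right_mem_segment ℝ p q)⟩) id
  · rintro (⟨hp, hq, hne, ⟨t, ht, hst⟩, ho⟩ | ⟨hp, hq, hne, ⟨t, ht, hst⟩, ho⟩)
    · refine ⟨Or.inl hp, Or.inl hq, hne, ⟨t, Or.inl ht, hst⟩, ?_⟩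
      rintro r (hr | hr) hro
      · exact ho r hr hro
      · exact ho r (h₂₁ ⟨hr, hS₁ t ht (hst (openSegment_subset_segment ℝ _ _ hro))⟩) hro
    · refine ⟨Or.inr hp, Or.inr hq, hne, ⟨t, Or.inr ht, hst⟩, ?_⟩
      rintro r (hr | hr) hro
      · exact ho r (h₁₂ ⟨hr, hS₂ t ht (hst (openSegment_subset_segment ℝ _ _ hro))⟩) hro
      · exact ho r hr hro

theorem mem_openSegment_image_lt (l : ℝ × ℝ →ₗ[ℝ] ℝ) {p q r : ℝ × ℝ} (hpq : l p < l q)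
    (hr : r ∈ openSegment ℝ p q) : l p < l r ∧ l r < l q := by
  have h : l.toAffineMap r ∈ l.toAffineMap '' openSegment ℝ p q := ⟨r, hr, rfl⟩
  rw [image_openSegment] at h
  simpa [openSegment_eq_Ioo hpq] using h

theorem exists_mem_openSegment_of_lt (l : ℝ × ℝ →ₗ[ℝ] ℝ) {p q : ℝ × ℝ} {x : ℝ} (hp : l p < x)
    (hq : x < l q) : ∃ r ∈ openSegment ℝ p q, l r = x := by
  have h : x ∈ l.toAffineMap '' openSegment ℝ p q := by
    rw [image_openSegment]
    simpa [openSegment_eq_Ioo (hp.trans hq)] using ⟨hp, hq⟩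
  obtain ⟨r, hr, h⟩ := h
  exact ⟨r, hr, h⟩

/-- Subdividing an edge raises the number of darts by two. -/
theorem ncard_darts_insert {X : Set (ℝ × ℝ)} (hX : X.Finite) {S : Set (Set (ℝ × ℝ))}
    (l : ℝ × ℝ →ₗ[ℝ] ℝ) {a b w : ℝ × ℝ} (ha : a ∈ X) (hb : b ∈ X) (haw : l a < l w)
    (hwb : l w < l b) (hw : w ∈ openSegment ℝ a b)
    (hab : ∀ r ∈ X, r ∈ segment ℝ a b → r = a ∨ r = b) (hS : segment ℝ a b ∈ S)
    (huniq : ∀ t ∈ S, w ∈ t → t = segment ℝ a b) :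
    (darts (insert w X) S).ncard = (darts X S).ncard + 2 := by
  have hws := openSegment_subset_segment ℝ _ _ hw
  have hwX : w ∉ X := fun h => by
    rcases hab w h hws with rfl | rfl
    · exact lt_irrefl _ haw
    · exact lt_irrefl _ hwb
  have hawne : a ≠ w := fun h => hwX (h ▸ ha)
  have hbwne : b ≠ w := fun h => hwX (h ▸ hb)
  have habne : a ≠ b := fun h => lt_irrefl _ ((haw.trans hwb).trans_eq (by rw [h]))
  have hsub : ∀ u v, u ∈ segment ℝ a b → v ∈ segment ℝ a b → segment ℝ u v ⊆ segment ℝ a b :=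
    fun u v hu hv => (convex_segment a b).segment_subset hu hv
  have hao : ∀ r ∈ insert w X, r ∉ openSegment ℝ a w := by
    rintro r hr hro
    have h1 := mem_openSegment_image_lt l haw hro
    rcases hr with rfl | hr
    · exact lt_irrefl _ h1.2
    · rcases hab r hr (hsub _ _ (left_mem_segment ℝ a b) hws
        (openSegment_subset_segment ℝ _ _ hro)) with rfl | rfl
      · exact lt_irrefl _ h1.1
      · exact lt_asymm hwb h1.2
  have hbo : ∀ r ∈ insert w X, r ∉ openSegment ℝ w b := by
    rintro r hr hro
    have h1 := mem_openSegment_image_lt l hwb hro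
    rcases hr with rfl | hr
    · exact lt_irrefl _ h1.1
    · rcases hab r hr (hsub _ _ hws (right_mem_segment ℝ a b)
        (openSegment_subset_segment ℝ _ _ hro)) with rfl | rfl
      · exact lt_asymm haw h1.1
      · exact lt_irrefl _ h1.2
  have hdaw : (a, w) ∈ darts (insert w X) S :=
    ⟨Or.inr ha, Or.inl rfl, hawne, ⟨_, hS, hsub _ _ (left_mem_segment ℝ a b) hws⟩, hao⟩
  have hdwb : (w, b) ∈ darts (insert w X) S :=
    ⟨Or.inl rfl, Or.inr hb, hbwne.symm, ⟨_, hS, hsub _ _ hws (right_mem_segment ℝ a b)⟩, hbo⟩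
  have hdab : (a, b) ∈ darts X S := by
    refine ⟨ha, hb, habne, ⟨_, hS, subset_rfl⟩, fun r hr hro => ?_⟩
    have h1 := mem_openSegment_image_lt l (haw.trans hwb) hro
    rcases hab r hr (openSegment_subset_segment ℝ _ _ hro) with rfl | rfl
    · exact lt_irrefl _ h1.1
    · exact lt_irrefl _ h1.2
  have hfromw : ∀ q, (w, q) ∈ darts (insert w X) S → q = a ∨ q = b := by
    rintro q ⟨-, hq, hne, ⟨t, ht, hst⟩, -⟩
    have := huniq t ht (hst (left_mem_segment ℝ _ _))
    subst this
    exact hab q (hq.resolve_left fun h => hne h.symm) (hst (right_mem_segment ℝ _ _))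
  -- The two orientations of the edge from `a` to `b` disappear and four darts at `w` appear; by
  -- `huniq` no other side meets `w`.
  have key : darts (insert w X) S =
      (darts X S \ {(a, b), (b, a)}) ∪ {(a, w), (w, a), (w, b), (b, w)} := by
    ext ⟨p, q⟩
    constructor
    · intro h
      by_cases hpw : p = w
      · subst hpw
        rcases hfromw q h with rfl | rfl <;> simp
      by_cases hqw : q = w
      · subst hqw
        rcases hfromw p (mk_mem_darts_comm.1 h) with rfl | rfl <;> simp
      obtain ⟨hp, hq, hne, ht, ho⟩ := h
      refine Or.inl ⟨⟨hp.resolve_left hpw, hq.resolve_left hqw, hne, ht,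
        fun r hr => ho r (Or.inr hr)⟩, ?_⟩
      rintro (h | h)
      · simp only [Prod.mk.injEq] at h
        obtain ⟨rfl, rfl⟩ := h
        exact ho w (Or.inl rfl) hw
      · simp only [Set.mem_singleton_iff, Prod.mk.injEq] at h
        obtain ⟨rfl, rfl⟩ := h
        exact ho w (Or.inl rfl) (openSegment_symm ℝ p q ▸ hw)
    · rintro (⟨⟨hp, hq, hne, ⟨t, ht, hst⟩, ho⟩, hn⟩ | h)
      · refine ⟨Or.inr hp, Or.inr hq, hne, ⟨t, ht, hst⟩, ?_⟩
        rintro r (rfl | hr) hro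
        · have := huniq t ht (hst (openSegment_subset_segment ℝ _ _ hro))
          subst this
          rcases hab p hp (hst (left_mem_segment ℝ _ _)) with rfl | rfl <;>
          rcases hab q hq (hst (right_mem_segment ℝ _ _)) with rfl | rfl <;> simp_all
        · exact ho r hr hro
      · simp only [Set.mem_insert_iff, Set.mem_singleton_iff, Prod.mk.injEq] at h
        rcases h with ⟨rfl, rfl⟩ | ⟨rfl, rfl⟩ | ⟨rfl, rfl⟩ | ⟨rfl, rfl⟩
        · exact hdaw
        · exact mk_mem_darts_comm.1 hdaw
        · exact hdwb
        · exact mk_mem_darts_comm.1 hdwb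
  have hfin := finite_darts hX S
  have hdba := mk_mem_darts_comm.1 hdab
  have h2 : ({(a, b), (b, a)} : Set ((ℝ × ℝ) × (ℝ × ℝ))).ncard = 2 :=
    Set.ncard_pair (by simp [habne])
  have h4 : ({(a, w), (w, a), (w, b), (b, w)} : Set ((ℝ × ℝ) × (ℝ × ℝ))).ncard = 4 := by
    rw [Set.ncard_insert_of_notMem (by simp [hawne, hawne.symm, hbwne.symm, habne]),
      Set.ncard_insert_of_notMem (by simp [hawne, hbwne.symm, habne]),
      Set.ncard_pair (by simp [hbwne.symm])]
  have hd := Set.ncard_sdiff_add_ncard_of_subset (s := {(a, b), (b, a)}) (t := darts X S)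
    (by rintro _ (rfl | rfl) <;> assumption) hfin
  rw [key, Set.ncard_union_eq ?_ (hfin.subset Set.sdiff_subset) (Set.toFinite _)]
  · omega
  · rw [Set.disjoint_left]
    rintro ⟨p, q⟩ ⟨⟨hp, hq, -⟩, -⟩ h
    simp only [Set.mem_insert_iff, Set.mem_singleton_iff, Prod.mk.injEq] at h
    rcases h with ⟨rfl, rfl⟩ | ⟨rfl, rfl⟩ | ⟨rfl, rfl⟩ | ⟨rfl, rfl⟩ <;> exact hwX ‹_›

/-! ### Paths ordered by a height function, and segments covered by tile sides. -/

/-- The ordered pairs of distinct points of `C` with no point of `C` strictly between them, where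
`l` is the height function that orders the points. -/
def consecutivePairs (l : ℝ × ℝ → ℝ) (C : Set (ℝ × ℝ)) : Set ((ℝ × ℝ) × (ℝ × ℝ)) :=
  {d | d.1 ∈ C ∧ d.2 ∈ C ∧ l d.1 < l d.2 ∧ ∀ r ∈ C, ¬(l d.1 < l r ∧ l r < l d.2)}

/-- Every point except the lowest is the upper end of exactly one pair, the lower end being the
highest point below it. So the second projection is a bijection onto `C` without its minimum. -/
theorem ncard_consecutivePairs {l : ℝ × ℝ → ℝ} {C : Set (ℝ × ℝ)} (hC : C.Finite)
    (hne : C.Nonempty) (hl : Set.InjOn l C) : (consecutivePairs l C).ncard + 1 = C.ncard := by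
  obtain ⟨m, hm, hmin⟩ := Set.exists_min_image C l hC hne
  have himg : Prod.snd '' consecutivePairs l C = C \ {m} := by
    ext q
    constructor
    · rintro ⟨⟨p, q⟩, ⟨hp, hq, hlt, -⟩, rfl⟩
      exact ⟨hq, by rintro rfl; exact absurd hlt (hmin p hp).not_gt⟩
    · rintro ⟨hq, hqm⟩
      have hlt : l m < l q := lt_of_le_of_ne (hmin q hq) fun h => hqm (hl hq hm h.symm)
      obtain ⟨p, ⟨hp, hpq⟩, hmax⟩ := Set.exists_max_image {p | p ∈ C ∧ l p < l q} l
        (hC.subset fun _ h => h.1) ⟨m, hm, hlt⟩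
      exact ⟨(p, q), ⟨hp, hq, hpq, fun r hr h => absurd h.1 (hmax r ⟨hr, h.2⟩).not_gt⟩, rfl⟩
  have hinj : Set.InjOn Prod.snd (consecutivePairs l C) := by
    rintro ⟨p, q⟩ ⟨hp, hq, hlt, ho⟩ ⟨p', q'⟩ ⟨hp', hq', hlt', ho'⟩ h
    simp only at h hp hp' hlt hlt' ho ho'
    subst h
    have : l p = l p' := by
      by_contra hn
      rcases lt_or_gt_of_ne hn with h | h
      · exact ho p' hp' ⟨h, hlt'⟩
      · exact ho' p hp ⟨h, hlt⟩
    rw [hl hp hp' this]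
  rw [← hinj.ncard_image, himg, Set.ncard_sdiff_singleton_add_one hm hC]

theorem ncard_consecutivePairs_symm {l : ℝ × ℝ → ℝ} {C : Set (ℝ × ℝ)} (hC : C.Finite)
    (hne : C.Nonempty) (hl : Set.InjOn l C) :
    (consecutivePairs l C ∪ Prod.swap '' consecutivePairs l C).ncard + 2 = 2 * C.ncard := by
  have hfin : (consecutivePairs l C).Finite := (hC.prod hC).subset fun _ h => ⟨h.1, h.2.1⟩
  rw [Set.ncard_union_eq ?_ hfin (hfin.image _),
    Set.ncard_image_of_injective _ Prod.swap_injective, ← ncard_consecutivePairs hC hne hl]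
  · ring
  · rw [Set.disjoint_left]
    rintro ⟨p, q⟩ h ⟨⟨p', q'⟩, h', he⟩
    simp only [Prod.swap, Prod.mk.injEq] at he
    obtain ⟨rfl, rfl⟩ := he
    exact lt_asymm h.2.2.1 h'.2.2.1

/-- Points of the segment from `P` to `Q` with no vertex of `X` between them lie on a common side
from `S`. -/
def CoversSegment (X : Set (ℝ × ℝ)) (S : Set (Set (ℝ × ℝ))) (P Q : ℝ × ℝ) : Prop :=
  ∀ p ∈ segment ℝ P Q, ∀ q ∈ segment ℝ P Q, (∀ r ∈ X, r ∉ openSegment ℝ p q) →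
    ∃ t ∈ S, segment ℝ p q ⊆ t

namespace CoversSegment

variable {X Y : Set (ℝ × ℝ)} {S T : Set (Set (ℝ × ℝ))} {P Q M P' Q' : ℝ × ℝ}

theorem symm (h : CoversSegment X S P Q) : CoversSegment X S Q P := by
  unfold CoversSegment at *
  rwa [segment_symm ℝ Q P]

theorem mono (h : CoversSegment X S P Q) (hX : X ⊆ Y) (hS : S ⊆ T) : CoversSegment Y T P Q :=
  fun p hp q hq ho =>
    let ⟨t, ht, hst⟩ := h p hp q hq fun r hr => ho r (hX hr)
    ⟨t, hS ht, hst⟩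

theorem of_mem (hS : segment ℝ P Q ∈ S) : CoversSegment X S P Q :=
  fun _ hp _ hq _ => ⟨_, hS, (convex_segment P Q).segment_subset hp hq⟩

theorem subsegment (h : CoversSegment X S P Q) (hP : P' ∈ segment ℝ P Q)
    (hQ : Q' ∈ segment ℝ P Q) : CoversSegment X S P' Q' :=
  fun p hp q hq ho =>
    have hs := (convex_segment P Q).segment_subset hP hQ
    h p (hs hp) q (hs hq) ho

theorem image (h : CoversSegment X S P Q) (f : ℝ × ℝ →ᵃ[ℝ] ℝ × ℝ) :
    CoversSegment (f '' X) (Set.image f '' S) (f P) (f Q) := by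
  intro p hp q hq ho
  rw [← image_segment] at hp hq
  obtain ⟨p, hp, rfl⟩ := hp
  obtain ⟨q, hq, rfl⟩ := hq
  obtain ⟨t, ht, hst⟩ := h p hp q hq fun r hr hro =>
    ho (f r) ⟨r, hr, rfl⟩ (by rw [← image_openSegment]; exact ⟨r, hro, rfl⟩)
  refine ⟨_, ⟨t, ht, rfl⟩, ?_⟩
  rw [← image_segment]
  exact Set.image_mono hst

end CoversSegment

-- The two similarities of the dissection and the recursion for the tilings.

local notation "ψ" => invPsi

theorem invPsi_pos : 0 < ψ := by unfold invPsi; positivity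

theorem invPsi_sq_add : ψ ^ 2 + ψ ^ 4 = 1 := by
  have h5 : Real.sqrt 5 ^ 2 = 5 := Real.sq_sqrt (by norm_num)
  have hφ : 0 < (1 + Real.sqrt 5) / 2 := by positivity
  have h2 : ψ ^ 2 = 1 / ((1 + Real.sqrt 5) / 2) := by
    rw [invPsi, div_pow, Real.sq_sqrt hφ.le, one_pow]
  have h4 : ψ ^ 4 = (ψ ^ 2) ^ 2 := by ring
  rw [h4, h2]
  field_simp
  nlinarith

theorem invPsi_lt_one : ψ < 1 := by
  nlinarith [invPsi_pos, invPsi_sq_add, pow_pos invPsi_pos 4]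

/-- The similarity that carries the large prototile to the large piece of its dissection. -/
noncomputable def largePiece : ℝ × ℝ →ᵃ[ℝ] ℝ × ℝ where
  toFun p := (ψ * p.2, ψ - ψ * p.1)
  linear := (ψ • LinearMap.snd ℝ ℝ ℝ).prod (-(ψ • LinearMap.fst ℝ ℝ ℝ))
  map_vadd' p v := by ext <;> simp <;> ring

/-- The similarity that carries the large prototile to the small piece of its dissection. -/
noncomputable def smallPiece : ℝ × ℝ →ᵃ[ℝ] ℝ × ℝ where
  toFun p := (1 - ψ ^ 2 * p.1, ψ ^ 2 * p.2)
  linear := (-(ψ ^ 2 • LinearMap.fst ℝ ℝ ℝ)).prod (ψ ^ 2 • LinearMap.snd ℝ ℝ ℝ)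
  map_vadd' p v := by ext <;> simp <;> ring

/-- Scaling of the plane by `invPsi`. -/
noncomputable def shrink : ℝ × ℝ →ᵃ[ℝ] ℝ × ℝ := (ψ • LinearMap.id).toAffineMap

theorem largePiece_apply (p : ℝ × ℝ) : largePiece p = (ψ * p.2, ψ - ψ * p.1) := rfl

theorem smallPiece_apply (p : ℝ × ℝ) : smallPiece p = (1 - ψ ^ 2 * p.1, ψ ^ 2 * p.2) := rfl

theorem largePiece_injective : Function.Injective largePiece := by
  rintro ⟨x, y⟩ ⟨x', y'⟩ h
  have := invPsi_pos.ne'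
  simp only [largePiece_apply, Prod.mk.injEq, sub_right_inj, mul_right_inj' this] at h
  simp [h]

theorem smallPiece_injective : Function.Injective smallPiece := by
  rintro ⟨x, y⟩ ⟨x', y'⟩ h
  have := (pow_pos invPsi_pos 2).ne'
  simp only [smallPiece_apply, Prod.mk.injEq, sub_right_inj, mul_right_inj' this] at h
  simp [h]

theorem shrink_injective : Function.Injective shrink :=
  fun _ _ h => smul_right_injective _ invPsi_pos.ne' h

/-- The tile moved by a map of the plane. -/
def Tile.move (g : ℝ × ℝ → ℝ × ℝ) (t : Tile) : Tile := ⟨t.kind, g ∘ t.place⟩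

theorem Tile.substitute_move (g : ℝ × ℝ → ℝ × ℝ) (t : Tile) :
    (t.move g).substitute = t.substitute.map (Tile.move g) := by
  obtain ⟨_ | _, p⟩ := t <;> rfl

theorem substitutionStep_map_move (g : ℝ × ℝ → ℝ × ℝ) (P : List Tile) :
    substitutionStep (P.map (Tile.move g)) = (substitutionStep P).map (Tile.move g) := by
  simp only [substitutionStep, List.flatMap_map, List.map_flatMap, Tile.substitute_move]

theorem iterate_substitutionStep_map_move (g : ℝ × ℝ → ℝ × ℝ) (n : ℕ) (P : List Tile) :
    substitutionStep^[n] (P.map (Tile.move g)) = (substitutionStep^[n] P).map (Tile.move g) := by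
  induction n generalizing P with
  | zero => rfl
  | succ n ih => rw [Function.iterate_succ_apply, substitutionStep_map_move, ih,
      Function.iterate_succ_apply]

theorem iterate_substitutionStep_append (n : ℕ) (P P' : List Tile) :
    substitutionStep^[n] (P ++ P') = substitutionStep^[n] P ++ substitutionStep^[n] P' := by
  induction n generalizing P P' with
  | zero => rfl
  | succ n ih =>
    simp only [Function.iterate_succ_apply]
    rw [← ih, substitutionStep, List.flatMap_append]
    rfl

/-- The tiling obtained from the large prototile by `n` substitution steps. -/
noncomputable def dissection (n : ℕ) : List Tile := substitutionStep^[n] [⟨.large, id⟩]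

/-- This moves the counting to the unit-size prototile: A2-2 is that prototile scaled by `ψ`, and a
similarity changes neither count. It causes the index shift by two below. -/
theorem ammannA2_add_two (n : ℕ) :
    ammannA2 (n + 2) = (dissection n).map (Tile.move shrink) := by
  rw [dissection, ← iterate_substitutionStep_map_move]
  rfl

theorem dissection_succ (n : ℕ) :
    dissection (n + 1) = (dissection n).map (Tile.move largePiece) ++
      substitutionStep^[n] [⟨.small, fun p => (1 - ψ * p.1, ψ * p.2)⟩] := by
  rw [dissection, dissection, ← iterate_substitutionStep_map_move,
    ← iterate_substitutionStep_append]
  rfl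

/-- The small piece spends one step on becoming a large tile in the same place, so its dissection
lags one step behind; its total scaling factor is therefore `ψ ^ 2`. -/
theorem dissection_add_two (n : ℕ) :
    dissection (n + 2) = (dissection (n + 1)).map (Tile.move largePiece) ++
      (dissection n).map (Tile.move smallPiece) := by
  rw [dissection_succ (n + 1)]
  congr 1
  rw [dissection, ← iterate_substitutionStep_map_move]
  have : (smallPiece : ℝ × ℝ → ℝ × ℝ) = fun p => (1 - ψ * (ψ • p).1, ψ * (ψ • p).2) := by
    ext p <;> simp [smallPiece_apply] <;> ring
  rw [Function.iterate_succ_apply, this]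
  rfl

/-- The corners of the tiles of `P`, as a set. -/
def cornerSet (P : List Tile) : Set (ℝ × ℝ) := {p | ∃ t ∈ P, ∃ i, t.corner i = p}

/-- The sides of the tiles of `P`. -/
def sideSet (P : List Tile) : Set (Set (ℝ × ℝ)) := {σ | ∃ t ∈ P, ∃ i, t.side i = σ}

theorem coe_corners (P : List Tile) : (corners P : Set (ℝ × ℝ)) = cornerSet P := by
  ext p
  simp [corners, cornerSet, Fin.exists_fin_succ, eq_comm]

theorem finite_cornerSet (P : List Tile) : (cornerSet P).Finite :=
  coe_corners P ▸ (corners P).finite_toSet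

theorem cornerSet_append (P P' : List Tile) :
    cornerSet (P ++ P') = cornerSet P ∪ cornerSet P' := by
  ext p
  simp [cornerSet, or_and_right, exists_or]

theorem sideSet_append (P P' : List Tile) : sideSet (P ++ P') = sideSet P ∪ sideSet P' := by
  ext p
  simp [sideSet, or_and_right, exists_or]

theorem cornerSet_map_move (g : ℝ × ℝ → ℝ × ℝ) (P : List Tile) :
    cornerSet (P.map (Tile.move g)) = g '' cornerSet P := by
  ext p
  constructor
  · rintro ⟨_, hm, i, rfl⟩
    obtain ⟨t, ht, rfl⟩ := List.mem_map.1 hm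
    exact ⟨_, ⟨t, ht, i, rfl⟩, rfl⟩
  · rintro ⟨_, ⟨t, ht, i, rfl⟩, rfl⟩
    exact ⟨_, List.mem_map_of_mem ht, i, rfl⟩

theorem Tile.side_move (g : ℝ × ℝ →ᵃ[ℝ] ℝ × ℝ) (t : Tile) (i : Fin 6) :
    (t.move g).side i = g '' t.side i := by
  rw [Tile.side, Tile.side, image_segment]
  rfl

theorem sideSet_map_move (g : ℝ × ℝ →ᵃ[ℝ] ℝ × ℝ) (P : List Tile) :
    sideSet (P.map (Tile.move g)) = Set.image g '' sideSet P := by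
  ext p
  simp [sideSet, Tile.side_move]

/-- The vertices of the `n`-th dissection of the large prototile. -/
noncomputable def verts (n : ℕ) : Set (ℝ × ℝ) := cornerSet (dissection n)

/-- The tile sides of the `n`-th dissection of the large prototile. -/
noncomputable def sides (n : ℕ) : Set (Set (ℝ × ℝ)) := sideSet (dissection n)

theorem finite_verts (n : ℕ) : (verts n).Finite := finite_cornerSet _

theorem verts_zero : verts 0 = Set.range largeHexagon := by
  ext p
  simp [verts, dissection, cornerSet, Tile.corner, TileKind.hexagon]

theorem sides_zero :
    sides 0 = Set.range fun i => segment ℝ (largeHexagon i) (largeHexagon (i + 1)) := by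
  ext p
  simp [sides, dissection, sideSet, Tile.side, Tile.corner, TileKind.hexagon]

theorem cornerSet_small (g : ℝ × ℝ → ℝ × ℝ) :
    cornerSet [⟨.small, g⟩] = (fun p => g (ψ • p)) '' verts 0 := by
  ext p
  simp [verts_zero, cornerSet, Tile.corner, TileKind.hexagon]

/-- The truncated `n - 1` is also right for `n = 0`: a small tile has the same outline as the large
tile that replaces it. The same holds for `sides_succ`. -/
theorem verts_succ (n : ℕ) :
    verts (n + 1) = largePiece '' verts n ∪ smallPiece '' verts (n - 1) := by
  have hs : (smallPiece : ℝ × ℝ → ℝ × ℝ) = fun p => (1 - ψ * (ψ • p).1, ψ * (ψ • p).2) := by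
    ext p <;> simp [smallPiece_apply] <;> ring
  cases n with
  | zero =>
    rw [verts, dissection_succ, cornerSet_append, cornerSet_map_move, Function.iterate_zero, id,
      cornerSet_small, hs]
    rfl
  | succ n =>
    rw [verts, dissection_add_two, cornerSet_append, cornerSet_map_move, cornerSet_map_move]
    rfl

theorem sides_succ (n : ℕ) :
    sides (n + 1) = Set.image largePiece '' sides n ∪ Set.image smallPiece '' sides (n - 1) := by
  have hs : (smallPiece : ℝ × ℝ → ℝ × ℝ) = fun p => (1 - ψ * (ψ • p).1, ψ * (ψ • p).2) := by
    ext p <;> simp [smallPiece_apply] <;> ring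
  cases n with
  | zero =>
    have h : sideSet [⟨.small, fun p => (1 - ψ * p.1, ψ * p.2)⟩] =
        Set.image smallPiece '' sides 0 := by
      rw [sides_zero, ← Set.range_comp]
      ext σ
      simp only [sideSet, Tile.side, Tile.corner, TileKind.hexagon, List.mem_singleton,
        exists_eq_left, Set.mem_ofPred_eq, Set.mem_range, Function.comp, image_segment]
      rw [hs]
    rw [sides, dissection_succ, sideSet_append, sideSet_map_move, Function.iterate_zero, id, h]
    rfl
  | succ n =>
    rw [sides, dissection_add_two, sideSet_append, sideSet_map_move, sideSet_map_move]
    rfl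

theorem totalDegree_tilingGraph (P : List Tile) :
    totalDegree (tilingGraph P) = (darts (cornerSet P) (sideSet P)).ncard := by
  classical
  have hmem : ∀ r, r ∈ corners P ↔ r ∈ cornerSet P := fun r => by
    rw [← coe_corners, Finset.mem_coe]
  have h : totalDegree (tilingGraph P) =
      Nat.card (Σ v, {w // (tilingGraph P).Adj v w}) := by
    rw [totalDegree, Nat.card_sigma]
    refine Finset.sum_congr rfl fun v _ => ?_
    rw [← SimpleGraph.card_neighborSet_eq_degree, Nat.card_eq_fintype_card]
    exact Fintype.card_congr (Equiv.refl _)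
  rw [h, ← Nat.card_coe_set_eq]
  refine Nat.card_congr ⟨fun x => ⟨(x.1.1, x.2.1.1), ?_⟩,
    fun d => ⟨⟨d.1.1, (hmem _).2 d.2.1⟩, ⟨⟨d.1.2, (hmem _).2 d.2.2.1⟩, ?_⟩⟩, ?_, ?_⟩
  · obtain ⟨⟨v, hv⟩, ⟨⟨w, hw⟩, hne, ⟨t, ht, i, hi⟩, ho⟩⟩ := x
    exact ⟨(hmem v).1 hv, (hmem w).1 hw, fun h => hne (Subtype.ext h), ⟨_, ⟨t, ht, i, rfl⟩, hi⟩,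
      fun r hr => ho r ((hmem r).2 hr)⟩
  · obtain ⟨⟨v, w⟩, hv, hw, hne, ⟨_, ⟨t, ht, i, rfl⟩, hi⟩, ho⟩ := d
    exact ⟨fun h => hne (congrArg Subtype.val h), ⟨t, ht, i, hi⟩,
      fun r hr => ho r ((hmem r).1 hr)⟩
  · intro x; rfl
  · intro x; rfl

theorem a2V_add_two (n : ℕ) : a2V (n + 2) = (verts n).ncard := by
  rw [a2V, Fintype.card_coe, ← Set.ncard_coe_finset, coe_corners, ammannA2_add_two,
    cornerSet_map_move, Set.ncard_image_of_injective _ shrink_injective]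
  rfl

theorem a2T_add_two (n : ℕ) : a2T (n + 2) = (darts (verts n) (sides n)).ncard := by
  rw [a2T, a2Graph, totalDegree_tilingGraph, ammannA2_add_two, cornerSet_map_move,
    sideSet_map_move, ncard_darts_image _ shrink_injective]
  rfl

theorem invPsi_three_add : ψ ^ 3 + ψ ^ 5 = ψ := by linear_combination ψ * invPsi_sq_add

theorem invPsi_four_add : ψ ^ 4 + ψ ^ 6 = ψ ^ 2 := by linear_combination ψ ^ 2 * invPsi_sq_add

theorem invPsi_five_add : ψ ^ 5 + ψ ^ 7 = ψ ^ 3 := by linear_combination ψ ^ 3 * invPsi_sq_add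

theorem invPsi_pow_pos (n : ℕ) : 0 < ψ ^ n := pow_pos invPsi_pos n

theorem invPsi_pow_lt {m n : ℕ} (h : m < n) : ψ ^ n < ψ ^ m :=
  pow_lt_pow_right_of_lt_one₀ invPsi_pos invPsi_lt_one h

/-! ### Regions of the pieces, which decide from which piece a vertex comes. -/

/-- The region occupied by the large prototile. -/
def region : Set (ℝ × ℝ) :=
  {p | 0 ≤ p.1 ∧ p.1 ≤ 1 ∧ 0 ≤ p.2 ∧ p.2 ≤ ψ ∧ (p.1 ≤ ψ ^ 2 ∨ p.2 ≤ ψ ^ 3)}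

/-- The region occupied by the large piece of the large prototile. -/
def largeRegion : Set (ℝ × ℝ) :=
  {p | 0 ≤ p.1 ∧ p.1 ≤ ψ ^ 2 ∧ 0 ≤ p.2 ∧ p.2 ≤ ψ ∧ (ψ ^ 5 ≤ p.2 ∨ p.1 ≤ ψ ^ 4)}

/-- The region occupied by the small piece of the large prototile. -/
def smallRegion : Set (ℝ × ℝ) :=
  {p | ψ ^ 4 ≤ p.1 ∧ p.1 ≤ 1 ∧ 0 ≤ p.2 ∧ p.2 ≤ ψ ^ 3 ∧ (ψ ^ 2 ≤ p.1 ∨ p.2 ≤ ψ ^ 5)}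

theorem largeRegion_subset : largeRegion ⊆ region := by
  rintro ⟨x, y⟩ ⟨h1, h2, h3, h4, -⟩
  exact ⟨h1, by linarith [invPsi_sq_add, invPsi_pow_pos 4], h3, h4, Or.inl h2⟩

theorem smallRegion_subset : smallRegion ⊆ region := by
  rintro ⟨x, y⟩ ⟨h1, h2, h3, h4, -⟩
  exact ⟨by linarith [invPsi_pow_pos 4], h2, h3,
    by linarith [invPsi_three_add, invPsi_pow_pos 5], Or.inr h4⟩

theorem largePiece_mem {p : ℝ × ℝ} (h : p ∈ region) : largePiece p ∈ largeRegion := by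
  obtain ⟨x, y⟩ := p
  obtain ⟨h1, h2, h3, h4, h5⟩ := h
  have hs := invPsi_pos
  simp only at h1 h2 h3 h4 h5
  refine ⟨mul_nonneg hs.le h3, ?_, ?_, ?_, ?_⟩ <;> simp only [largePiece_apply]
  · nlinarith
  · nlinarith
  · nlinarith
  · rcases h5 with h5 | h5
    · left; nlinarith [mul_le_mul_of_nonneg_left h5 hs.le, invPsi_three_add]
    · right; nlinarith [mul_le_mul_of_nonneg_left h5 hs.le]

theorem smallPiece_mem {p : ℝ × ℝ} (h : p ∈ region) : smallPiece p ∈ smallRegion := by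
  obtain ⟨x, y⟩ := p
  obtain ⟨h1, h2, h3, h4, h5⟩ := h
  have hs := invPsi_pow_pos 2
  simp only at h1 h2 h3 h4 h5
  refine ⟨?_, ?_, mul_nonneg hs.le h3, ?_, ?_⟩ <;> simp only [smallPiece_apply]
  · nlinarith [mul_le_mul_of_nonneg_left h2 hs.le, invPsi_sq_add]
  · nlinarith
  · nlinarith [mul_le_mul_of_nonneg_left h4 hs.le]
  · rcases h5 with h5 | h5
    · left; nlinarith [mul_le_mul_of_nonneg_left h5 hs.le, invPsi_sq_add]
    · right; nlinarith [mul_le_mul_of_nonneg_left h5 hs.le]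

theorem segment_subset_box {p q : ℝ × ℝ} {a b c d : ℝ} (hp : p ∈ Set.Icc a b ×ˢ Set.Icc c d)
    (hq : q ∈ Set.Icc a b ×ˢ Set.Icc c d) : segment ℝ p q ⊆ Set.Icc a b ×ˢ Set.Icc c d :=
  ((convex_Icc a b).prod (convex_Icc c d)).segment_subset hp hq

theorem subset_region_of_mem_sides_zero {t : Set (ℝ × ℝ)} (ht : t ∈ sides 0) : t ⊆ region := by
  rw [sides_zero] at ht
  obtain ⟨i, rfl⟩ := ht
  have h2 := invPsi_pow_pos 2
  have h3 := invPsi_pow_pos 3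
  have h4 := invPsi_pow_pos 4
  have h5 := invPsi_pow_pos 5
  have e1 := invPsi_sq_add
  have e3 := invPsi_three_add
  have hlow : Set.Icc 0 1 ×ˢ Set.Icc 0 (ψ ^ 3) ⊆ region := by
    rintro ⟨x, y⟩ ⟨⟨h1, h2⟩, h3, h4⟩
    exact ⟨h1, h2, h3, by simp only at *; linarith, Or.inr h4⟩
  have hleft : Set.Icc 0 (ψ ^ 2) ×ˢ Set.Icc 0 ψ ⊆ region := by
    rintro ⟨x, y⟩ ⟨⟨h1, h2⟩, h3, h4⟩
    exact ⟨h1, by simp only at *; linarith, h3, h4, Or.inl h2⟩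
  fin_cases i
  · refine (segment_subset_box ?_ ?_).trans hlow <;>
    simp [largeHexagon, h3.le]
  · refine (segment_subset_box ?_ ?_).trans hlow <;>
    simp [largeHexagon, h3.le]
  · refine (segment_subset_box ?_ ?_).trans hlow <;>
    simp [largeHexagon, h3.le, h2.le, abs_of_pos invPsi_pos, invPsi_lt_one.le]
  · refine (segment_subset_box ?_ ?_).trans hleft <;>
    simp [largeHexagon, h3.le, h2.le, invPsi_pos.le]
    linarith
  · refine (segment_subset_box ?_ ?_).trans hleft <;>
    simp [largeHexagon, h2.le, invPsi_pos.le]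
  · refine (segment_subset_box ?_ ?_).trans hleft <;>
    simp [largeHexagon, h2.le, invPsi_pos.le]

theorem subset_region_of_mem_sides {n : ℕ} {t : Set (ℝ × ℝ)} (ht : t ∈ sides n) : t ⊆ region := by
  induction n using Nat.strong_induction_on generalizing t with
  | _ n ih =>
    cases n with
    | zero => exact subset_region_of_mem_sides_zero ht
    | succ n =>
      rw [sides_succ] at ht
      rcases ht with ⟨t, ht, rfl⟩ | ⟨t, ht, rfl⟩
      · rintro _ ⟨p, hp, rfl⟩
        exact largeRegion_subset (largePiece_mem (ih n (by omega) ht hp))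
      · rintro _ ⟨p, hp, rfl⟩
        exact smallRegion_subset (smallPiece_mem (ih (n - 1) (by omega) ht hp))

theorem cornerSet_subset_side {P : List Tile} {p : ℝ × ℝ} (hp : p ∈ cornerSet P) :
    ∃ t ∈ sideSet P, p ∈ t :=
  let ⟨t, ht, i, hi⟩ := hp
  ⟨_, ⟨t, ht, i, rfl⟩, hi ▸ left_mem_segment ℝ _ _⟩

theorem verts_subset_region (n : ℕ) : verts n ⊆ region := fun _ hp =>
  let ⟨_, ht, hpt⟩ := cornerSet_subset_side hp
  subset_region_of_mem_sides ht hpt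

theorem largePiece_mem_verts {n : ℕ} {p : ℝ × ℝ} (hp : p ∈ verts n) :
    largePiece p ∈ verts (n + 1) := verts_succ n ▸ Or.inl ⟨p, hp, rfl⟩

theorem smallPiece_mem_verts {n : ℕ} {p : ℝ × ℝ} (hp : p ∈ verts (n - 1)) :
    smallPiece p ∈ verts (n + 1) := verts_succ n ▸ Or.inr ⟨p, hp, rfl⟩

/-- Off the region of the small piece, a vertex can only come from the large piece. This and its
counterpart below transport membership questions back by one step. -/
theorem largePiece_mem_verts_iff {n : ℕ} {p : ℝ × ℝ} (hp : largePiece p ∉ smallRegion) :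
    largePiece p ∈ verts (n + 1) ↔ p ∈ verts n := by
  refine ⟨fun h => ?_, largePiece_mem_verts⟩
  rw [verts_succ] at h
  rcases h with ⟨q, hq, h⟩ | ⟨q, hq, h⟩
  · rwa [← largePiece_injective h]
  · exact absurd (h ▸ smallPiece_mem (verts_subset_region _ hq)) hp

theorem smallPiece_mem_verts_iff {n : ℕ} {p : ℝ × ℝ} (hp : smallPiece p ∉ largeRegion) :
    smallPiece p ∈ verts (n + 1) ↔ p ∈ verts (n - 1) := by
  refine ⟨fun h => ?_, smallPiece_mem_verts⟩
  rw [verts_succ] at h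
  rcases h with ⟨q, hq, h⟩ | ⟨q, hq, h⟩
  · exact absurd (h ▸ largePiece_mem (verts_subset_region _ hq)) hp
  · rwa [← smallPiece_injective h]

theorem largePiece_corners :
    largePiece (largeHexagon 0) = largeHexagon 5 ∧ largePiece (largeHexagon 1) = largeHexagon 0 ∧
    largePiece (largeHexagon 2) = (ψ ^ 4, 0) ∧ largePiece (largeHexagon 3) = (ψ ^ 4, ψ ^ 5) ∧
    largePiece (largeHexagon 4) = (ψ ^ 2, ψ ^ 5) ∧ largePiece (largeHexagon 5) = largeHexagon 4 := by
  have e3 := invPsi_three_add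
  refine ⟨?_, ?_, ?_, ?_, ?_, ?_⟩ <;> ext <;> simp [largePiece_apply, largeHexagon] <;>
    linarith

theorem smallPiece_corners :
    smallPiece (largeHexagon 0) = largeHexagon 1 ∧ smallPiece (largeHexagon 1) = (ψ ^ 4, 0) ∧
    smallPiece (largeHexagon 2) = (ψ ^ 4, ψ ^ 5) ∧ smallPiece (largeHexagon 3) = (ψ ^ 2, ψ ^ 5) ∧
    smallPiece (largeHexagon 4) = largeHexagon 3 ∧
    smallPiece (largeHexagon 5) = largeHexagon 2 := by
  have e1 := invPsi_sq_add
  refine ⟨?_, ?_, ?_, ?_, ?_, ?_⟩ <;> ext <;> simp [smallPiece_apply, largeHexagon] <;>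
    linarith

theorem largeHexagon_mem_verts (n : ℕ) (i : Fin 6) : largeHexagon i ∈ verts n := by
  induction n using Nat.strong_induction_on generalizing i with
  | _ n ih =>
    cases n with
    | zero => exact verts_zero ▸ ⟨i, rfl⟩
    | succ n =>
      have hl := fun i => largePiece_mem_verts (ih n (by omega) i)
      have hs := fun i => smallPiece_mem_verts (ih (n - 1) (by omega) i)
      obtain ⟨l0, l1, -, -, -, l5⟩ := largePiece_corners
      obtain ⟨s0, -, -, -, s4, s5⟩ := smallPiece_corners
      fin_cases i
      exacts [l1 ▸ hl 1, s0 ▸ hs 0, s5 ▸ hs 5, s4 ▸ hs 4, l5 ▸ hl 5, l0 ▸ hl 0]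

/-! ### Vertices on the six sides, all reduced to the bottom side. -/

/-- Parametrizations by `[0, 1]` of the six sides of the large prototile, directed so that the
vertices on all sides belong to the same family of parameter sets. -/
noncomputable def sidePoint (i : Fin 6) (a : ℝ) : ℝ × ℝ :=
  ![(a, 0), (1, ψ ^ 3 * (1 - a)), (1 - ψ ^ 4 * (1 - a), ψ ^ 3), (ψ ^ 2, ψ - ψ ^ 5 * a),
    (ψ ^ 2 * (1 - a), ψ), (0, ψ * (1 - a))] i

theorem sidePoint_zero (i : Fin 6) : sidePoint i 0 = largeHexagon (![0, 2, 3, 4, 4, 5] i) := by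
  have e1 := invPsi_sq_add
  fin_cases i <;> ext <;> simp [sidePoint, largeHexagon]
  linarith

theorem sidePoint_one (i : Fin 6) : sidePoint i 1 = largeHexagon (![1, 1, 2, 3, 5, 0] i) := by
  have e1 := invPsi_three_add
  fin_cases i <;> ext <;> simp [sidePoint, largeHexagon]
  linarith

theorem sidePoint_zero_mem_verts (n : ℕ) (i : Fin 6) : sidePoint i 0 ∈ verts n :=
  sidePoint_zero i ▸ largeHexagon_mem_verts n _

theorem sidePoint_one_mem_verts (n : ℕ) (i : Fin 6) : sidePoint i 1 ∈ verts n :=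
  sidePoint_one i ▸ largeHexagon_mem_verts n _

theorem sidePoint_mem_verts_zero (i : Fin 6) {a : ℝ} (h0 : 0 ≤ a) (h1 : a ≤ 1) :
    sidePoint i a ∈ verts 0 ↔ a = 0 ∨ a = 1 := by
  constructor
  · rw [verts_zero]
    rintro ⟨j, hj⟩
    by_contra! hn
    have h0 : 0 < a := lt_of_le_of_ne h0 hn.1.symm
    have h1 : 0 < 1 - a := sub_pos.2 (lt_of_le_of_ne h1 hn.2)
    have s0 := invPsi_pos
    have s2 := invPsi_pow_pos 2
    have s3 := invPsi_pow_pos 3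
    have s4 := invPsi_pow_pos 4
    have s5 := invPsi_pow_pos 5
    have e1 := invPsi_sq_add
    have e3 := invPsi_three_add
    have m1 := mul_pos s0 h1
    have m2 := mul_pos s2 h1
    have m3 := mul_pos s3 h1
    have m4 := mul_pos s4 h1
    have m5 := mul_pos s5 h1
    have n1 := mul_pos s0 h0
    have n2 := mul_pos s2 h0
    have n3 := mul_pos s3 h0
    have n4 := mul_pos s4 h0
    have n5 := mul_pos s5 h0
    have hj1 := congrArg Prod.fst hj
    have hj2 := congrArg Prod.snd hj
    clear hj hn
    fin_cases i <;> fin_cases j <;> simp [sidePoint, largeHexagon] at hj1 hj2 <;>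
      first | linarith | (rcases hj1 with h | h <;> linarith) | (rcases hj2 with h | h <;> linarith)
  · rintro (rfl | rfl)
    exacts [sidePoint_zero_mem_verts 0 i, sidePoint_one_mem_verts 0 i]

/-- The abscissas of the vertices on the bottom side in the `n`-th dissection. -/
def bottom (n : ℕ) : Set ℝ := {a | sidePoint 0 a ∈ verts n}

theorem zero_mem_bottom (n : ℕ) : 0 ∈ bottom n := sidePoint_zero_mem_verts n 0

theorem one_mem_bottom (n : ℕ) : 1 ∈ bottom n := sidePoint_one_mem_verts n 0

theorem bottom_subset (n : ℕ) : bottom n ⊆ Set.Icc 0 1 :=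
  fun _ ha => ⟨(verts_subset_region n ha).1, (verts_subset_region n ha).2.1⟩

theorem finite_bottom (n : ℕ) : (bottom n).Finite :=
  (finite_verts n).preimage (Function.Injective.injOn fun a b h => by
    simpa [sidePoint] using congrArg Prod.fst h)

theorem mem_bottom_zero {a : ℝ} (h0 : 0 ≤ a) (h1 : a ≤ 1) : a ∈ bottom 0 ↔ a = 0 ∨ a = 1 :=
  sidePoint_mem_verts_zero 0 h0 h1

theorem bottom_zero : bottom 0 = {0, 1} := by
  ext a
  constructor
  · intro h
    exact (mem_bottom_zero (bottom_subset 0 h).1 (bottom_subset 0 h).2).1 h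
  · rintro (rfl | rfl)
    exacts [zero_mem_bottom 0, one_mem_bottom 0]

theorem largePiece_sidePoint_zero (a : ℝ) : largePiece (sidePoint 0 a) = sidePoint 5 a := by
  ext <;> simp [sidePoint, largePiece_apply]; ring

theorem largePiece_sidePoint_one (a : ℝ) :
    largePiece (sidePoint 1 a) = sidePoint 0 (ψ ^ 4 * (1 - a)) := by
  ext <;> simp [sidePoint, largePiece_apply]; ring

theorem largePiece_sidePoint_four (a : ℝ) :
    largePiece (sidePoint 4 (1 - ψ ^ 2 * a)) = sidePoint 3 a := by
  ext <;> simp [sidePoint, largePiece_apply] <;> ring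

theorem largePiece_sidePoint_five (a : ℝ) : largePiece (sidePoint 5 a) = sidePoint 4 a := by
  ext <;> simp [sidePoint, largePiece_apply]; ring

theorem smallPiece_sidePoint_zero (a : ℝ) :
    smallPiece (sidePoint 0 a) = sidePoint 0 (1 - ψ ^ 2 * a) := by
  ext <;> simp [sidePoint, smallPiece_apply]

theorem smallPiece_sidePoint_four (a : ℝ) : smallPiece (sidePoint 4 a) = sidePoint 2 a := by
  ext <;> simp [sidePoint, smallPiece_apply] <;> ring

theorem smallPiece_sidePoint_five (a : ℝ) : smallPiece (sidePoint 5 a) = sidePoint 1 a := by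
  ext <;> simp [sidePoint, smallPiece_apply]; ring

section Trace

variable {n : ℕ} {a : ℝ}

theorem sidePoint_five_mem_verts (h0 : 0 ≤ a) (h1 : a ≤ 1) :
    sidePoint 5 a ∈ verts n ↔ a ∈ bottom (n - 1) := by
  cases n with
  | zero => rw [sidePoint_mem_verts_zero 5 h0 h1, mem_bottom_zero h0 h1]
  | succ n =>
    rw [← largePiece_sidePoint_zero, largePiece_mem_verts_iff]
    · rfl
    · rw [largePiece_sidePoint_zero]
      rintro ⟨h, -⟩
      exact (invPsi_pow_pos 4).not_ge h

theorem sidePoint_four_mem_verts (h0 : 0 ≤ a) (h1 : a ≤ 1) :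
    sidePoint 4 a ∈ verts n ↔ a ∈ bottom (n - 2) := by
  cases n with
  | zero => rw [sidePoint_mem_verts_zero 4 h0 h1, mem_bottom_zero h0 h1]
  | succ n =>
    rw [← largePiece_sidePoint_five, largePiece_mem_verts_iff, sidePoint_five_mem_verts h0 h1]
    · rfl
    · rw [largePiece_sidePoint_five]
      rintro ⟨-, -, -, h, -⟩
      change ψ ≤ ψ ^ 3 at h
      linarith [invPsi_three_add, invPsi_pow_pos 5]

theorem sidePoint_one_mem_verts_iff (h0 : 0 ≤ a) (h1 : a ≤ 1) :
    sidePoint 1 a ∈ verts n ↔ a ∈ bottom (n - 3) := by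
  cases n with
  | zero => rw [sidePoint_mem_verts_zero 1 h0 h1, mem_bottom_zero h0 h1]
  | succ n =>
    rw [← smallPiece_sidePoint_five, smallPiece_mem_verts_iff, sidePoint_five_mem_verts h0 h1]
    · rfl
    · rw [smallPiece_sidePoint_five]
      rintro ⟨-, h, -⟩
      change 1 ≤ ψ ^ 2 at h
      linarith [invPsi_sq_add, invPsi_pow_pos 4]

theorem sidePoint_two_mem_verts (h0 : 0 ≤ a) (h1 : a ≤ 1) :
    sidePoint 2 a ∈ verts n ↔ a ∈ bottom (n - 4) := by
  cases n with
  | zero => rw [sidePoint_mem_verts_zero 2 h0 h1, mem_bottom_zero h0 h1]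
  | succ n =>
    -- At `a = 0` the point is the reentrant corner, which also lies in `largeRegion`, so pulling
    -- back is not allowed there.
    rcases eq_or_lt_of_le h0 with rfl | h0'
    · simp only [sidePoint_zero_mem_verts, zero_mem_bottom]
    rw [← smallPiece_sidePoint_four, smallPiece_mem_verts_iff, sidePoint_four_mem_verts h0 h1]
    · rfl
    · rw [smallPiece_sidePoint_four]
      rintro ⟨-, h, -⟩
      change 1 - ψ ^ 4 * (1 - a) ≤ ψ ^ 2 at h
      linarith [invPsi_sq_add, mul_pos (invPsi_pow_pos 4) h0']

/-- The bottom side is cut at `ψ ^ 4`. Its left part is the right side of the large piece, whose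
delay is 3; its right part is the bottom side of the small piece, whose delay is 1. -/
theorem exists_of_mem_bottom_succ (h : a ∈ bottom (n + 1)) :
    (∃ b ∈ bottom (n - 3), a = ψ ^ 4 * (1 - b)) ∨ ∃ b ∈ bottom (n - 1), a = 1 - ψ ^ 2 * b := by
  have hm : sidePoint 0 a ∈ verts (n + 1) := h
  rw [verts_succ] at hm
  rcases hm with ⟨⟨x, y⟩, hp, he⟩ | ⟨⟨x, y⟩, hp, he⟩
  · left
    have hr := verts_subset_region _ hp
    simp only [sidePoint, largePiece_apply, Matrix.cons_val_zero, Prod.mk.injEq] at he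
    obtain ⟨he1, he2⟩ := he
    have hx : x = 1 := by
      have h : ψ * (1 - x) = 0 := by linarith
      linarith [(mul_eq_zero.1 h).resolve_left invPsi_pos.ne']
    subst hx
    obtain ⟨-, -, hy0, -, hy⟩ := hr
    have h2 : ¬ (1 : ℝ) ≤ ψ ^ 2 := by linarith [invPsi_sq_add, invPsi_pow_pos 4]
    simp only at hy0
    replace hy := hy.resolve_left h2
    have h3 := invPsi_pow_pos 3
    obtain ⟨b, rfl⟩ : ∃ b, ψ ^ 3 * (1 - b) = y :=
      ⟨1 - y / ψ ^ 3, by rw [sub_sub_cancel, mul_div_cancel₀ _ h3.ne']⟩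
    have hb0 : 0 ≤ b := by
      by_contra! hb
      exact hy.not_gt (by simp only; nlinarith)
    have hb1 : b ≤ 1 := sub_nonneg.1 (nonneg_of_mul_nonneg_right hy0 h3)
    exact ⟨b, (sidePoint_one_mem_verts_iff hb0 hb1).1 hp, by rw [← he1]; ring⟩
  · right
    simp only [sidePoint, smallPiece_apply, Matrix.cons_val_zero, Prod.mk.injEq] at he
    obtain ⟨he1, he2⟩ := he
    have hy : y = 0 := by simpa [(invPsi_pow_pos 2).ne', invPsi_pos.ne'] using he2
    subst hy
    exact ⟨x, hp, he1.symm⟩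

theorem mul_one_sub_mem_bottom_succ (h : a ∈ bottom (n - 3)) :
    ψ ^ 4 * (1 - a) ∈ bottom (n + 1) := by
  have ha := bottom_subset _ h
  change sidePoint 0 _ ∈ verts _
  rw [← largePiece_sidePoint_one]
  exact largePiece_mem_verts ((sidePoint_one_mem_verts_iff ha.1 ha.2).2 h)

theorem one_sub_mul_mem_bottom_succ (h : a ∈ bottom (n - 1)) :
    1 - ψ ^ 2 * a ∈ bottom (n + 1) := by
  change sidePoint 0 _ ∈ verts _
  rw [← smallPiece_sidePoint_zero]
  exact smallPiece_mem_verts h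

theorem bottom_succ (n : ℕ) :
    bottom (n + 1) = (fun b => ψ ^ 4 * (1 - b)) '' bottom (n - 3) ∪
      (fun b => 1 - ψ ^ 2 * b) '' bottom (n - 1) := by
  ext a
  constructor
  · intro h
    rcases exists_of_mem_bottom_succ h with ⟨b, hb, rfl⟩ | ⟨b, hb, rfl⟩
    exacts [Or.inl ⟨b, hb, rfl⟩, Or.inr ⟨b, hb, rfl⟩]
  · rintro (⟨b, hb, rfl⟩ | ⟨b, hb, rfl⟩)
    exacts [mul_one_sub_mem_bottom_succ hb, one_sub_mul_mem_bottom_succ hb]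

theorem one_sub_mul_mem_bottom (h0 : 0 ≤ a) (h1 : a ≤ 1) (hn : 1 - ψ ^ 2 * a ∈ bottom n) :
    a ∈ bottom (n - 2) := by
  have s2 := invPsi_pow_pos 2
  cases n with
  | zero =>
    rw [bottom_zero] at hn
    rcases hn with hn | hn
    · nlinarith [invPsi_sq_add, invPsi_pow_pos 4]
    · rw [Set.mem_singleton_iff, sub_eq_self, mul_eq_zero] at hn
      rw [hn.resolve_left s2.ne']
      exact zero_mem_bottom _
  | succ n =>
    rcases exists_of_mem_bottom_succ hn with ⟨b, hb, he⟩ | ⟨b, hb, he⟩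
    · have hb' := bottom_subset _ hb
      have : a = 1 := by
        nlinarith [invPsi_sq_add, mul_nonneg (invPsi_pow_pos 4).le hb'.1]
      exact this ▸ one_mem_bottom _
    · rwa [mul_left_cancel₀ s2.ne' (sub_right_injective he)]

/-- For `a = 0` the point is the cut `ψ ^ 4` itself, which is not yet a vertex when `n = 0`. The
disjunct `a = 0` supplies it, just as `topPoint` is inserted in `largeVerts`. -/
theorem mul_one_sub_mem_bottom_iff (h0 : 0 ≤ a) (h1 : a ≤ 1) :
    a = 0 ∨ ψ ^ 4 * (1 - a) ∈ bottom n ↔ a ∈ bottom (n - 4) := by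
  have s2 := invPsi_pow_pos 2
  have s4 := invPsi_pow_pos 4
  have e1 := invPsi_sq_add
  constructor
  · rintro (rfl | h)
    · exact zero_mem_bottom _
    cases n with
    | zero =>
      rw [bottom_zero] at h
      rcases h with h | h
      · rw [mul_eq_zero, sub_eq_zero] at h
        exact h.resolve_left s4.ne' ▸ one_mem_bottom _
      · rw [Set.mem_singleton_iff] at h
        nlinarith
    | succ n =>
      rcases exists_of_mem_bottom_succ h with ⟨b, hb, he⟩ | ⟨b, hb, he⟩
      · rwa [sub_right_injective (mul_left_cancel₀ s4.ne' he)]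
      · have hb' := bottom_subset _ hb
        have : a = 0 := by
          nlinarith [mul_nonneg s2.le (sub_nonneg.2 hb'.2)]
        exact this ▸ zero_mem_bottom _
  · intro h
    cases n with
    | zero =>
      rcases (mem_bottom_zero h0 h1).1 h with rfl | rfl
      · exact Or.inl rfl
      · exact Or.inr (by simpa using zero_mem_bottom 0)
    | succ n => exact Or.inr (mul_one_sub_mem_bottom_succ h)

theorem sidePoint_three_mem_verts (h0 : 0 ≤ a) (h1 : a ≤ 1) :
    sidePoint 3 a ∈ verts n ↔ a ∈ bottom (n - 5) := by
  have s2 := invPsi_pow_pos 2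
  have hlt : ψ ^ 2 < 1 := by linarith [invPsi_sq_add, invPsi_pow_pos 4]
  have hb0 : 0 ≤ 1 - ψ ^ 2 * a := by nlinarith
  have hb1 : 1 - ψ ^ 2 * a ≤ 1 := by nlinarith
  cases n with
  | zero => rw [sidePoint_mem_verts_zero 3 h0 h1, mem_bottom_zero h0 h1]
  | succ n =>
    -- At `a = 1` the point is the reentrant corner: always a vertex, thanks to the small piece, but
    -- not always one of the large piece.
    rcases eq_or_lt_of_le h1 with rfl | h1'
    · simp only [sidePoint_one_mem_verts, one_mem_bottom]
    rw [← largePiece_sidePoint_four, largePiece_mem_verts_iff, sidePoint_four_mem_verts hb0 hb1]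
    · refine ⟨fun h => one_sub_mul_mem_bottom h0 h1 h, fun h => ?_⟩
      -- For `n < 3` both indices truncate to 0, where only the endpoints are vertices; from 3 on
      -- the recursion for the bottom side applies.
      rcases Nat.lt_or_ge n 3 with hn | hn
      · have h5 : n + 1 - 5 = 0 := by omega
        have h2 : n - 2 = 0 := by omega
        rw [h5] at h
        rw [h2]
        rcases (mem_bottom_zero h0 h1).1 h with rfl | rfl
        · simpa using one_mem_bottom 0
        · exact absurd h1' (lt_irrefl _)
      · obtain ⟨m, rfl⟩ := Nat.exists_eq_add_of_le' hn
        exact one_sub_mul_mem_bottom_succ (n := m) h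
    · rw [largePiece_sidePoint_four]
      rintro ⟨-, -, -, h, -⟩
      change ψ - ψ ^ 5 * a ≤ ψ ^ 3 at h
      nlinarith [invPsi_three_add, invPsi_pow_pos 5]

end Trace

theorem ncard_union_add_one {α : Type*} {s t : Set α} (hs : s.Finite) (ht : t.Finite) {p : α}
    (h : s ∩ t = {p}) : (s ∪ t).ncard + 1 = s.ncard + t.ncard := by
  rw [← Set.ncard_union_add_ncard_inter s t hs ht, h, Set.ncard_singleton]

theorem ncard_bottom_succ (n : ℕ) :
    (bottom (n + 1)).ncard + 1 = (bottom (n - 3)).ncard + (bottom (n - 1)).ncard := by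
  have s2 := invPsi_pow_pos 2
  have s4 := invPsi_pow_pos 4
  have e1 := invPsi_sq_add
  rw [bottom_succ, ncard_union_add_one (p := ψ ^ 4) ((finite_bottom _).image _)
    ((finite_bottom _).image _), Set.ncard_image_of_injective, Set.ncard_image_of_injective]
  · exact fun a b h => mul_left_cancel₀ s2.ne' (sub_right_injective h)
  · exact fun a b h => sub_right_injective (mul_left_cancel₀ s4.ne' h)
  · ext a
    constructor
    · rintro ⟨⟨b, hb, rfl⟩, ⟨c, hc, he⟩⟩
      have hb' := bottom_subset _ hb
      have hc' := bottom_subset _ hc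
      simp only [Set.mem_singleton_iff] at he ⊢
      nlinarith [mul_nonneg s2.le (sub_nonneg.2 hc'.2), mul_nonneg s4.le hb'.1]
    · rintro rfl
      exact ⟨⟨0, zero_mem_bottom _, by simp⟩, ⟨1, one_mem_bottom _, by simp only; linarith⟩⟩

/-- The recursion refers back by two and by four steps, so each parity class runs through the
Fibonacci numbers; the extra 1 absorbs the shared cut point. -/
theorem ncard_bottom (n : ℕ) : (bottom n).ncard = Nat.fib ((n + 1) / 2 + 2) + 1 := by
  induction n using Nat.strong_induction_on with
  | _ n ih =>
    cases n with
    | zero => rw [bottom_zero, Set.ncard_pair zero_ne_one]; rfl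
    | succ n =>
      have h := ncard_bottom_succ n
      rw [ih (n - 3) (by omega), ih (n - 1) (by omega)] at h
      rcases Nat.lt_or_ge n 2 with hn | hn
      · rw [show n - 3 = 0 by omega, show n - 1 = 0 by omega] at h
        rw [show (n + 1 + 1) / 2 + 2 = 3 by omega]
        have h2 : Nat.fib 2 = 1 := rfl
        have h3 : Nat.fib 3 = 2 := rfl
        simp only [zero_add, Nat.reduceDiv, h2] at h
        omega
      · have h1 : (n + 1 + 1) / 2 + 2 = ((n - 3 + 1) / 2 + 2) + 2 ∧
          (n - 1 + 1) / 2 + 2 = ((n - 3 + 1) / 2 + 2) + 1 ∨ n = 2 := by omega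
        rcases h1 with ⟨h1, h2⟩ | rfl
        · rw [h1, Nat.fib_add_two]
          rw [h2] at h
          omega
        · norm_num [Nat.fib_add_two] at h ⊢
          omega

/-! ### The two pieces have the same vertices on their common boundary. -/

/-- The point of the top side of the large prototile that the large piece carries to the reentrant
corner of the large prototile. -/
noncomputable def topPoint : ℝ × ℝ := (ψ ^ 4, ψ)

theorem sidePoint_four_eq_topPoint : sidePoint 4 (ψ ^ 4) = topPoint := by
  ext
  · simp [sidePoint, topPoint]; linarith [invPsi_sq_add, invPsi_four_add]
  · simp [sidePoint, topPoint]

theorem largePiece_topPoint : largePiece topPoint = largeHexagon 3 := by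
  ext
  · simp [topPoint, largePiece_apply, largeHexagon]; ring
  · simp [topPoint, largePiece_apply, largeHexagon]; linarith [invPsi_three_add]

/-- The vertices on the large piece, including the reentrant corner of the large prototile. -/
noncomputable def largeVerts (n : ℕ) : Set (ℝ × ℝ) := largePiece '' insert topPoint (verts n)

/-- The vertices on the small piece. -/
noncomputable def smallVerts (n : ℕ) : Set (ℝ × ℝ) := smallPiece '' verts (n - 1)

/-- Inserting `topPoint` changes nothing in the union, because its image is a corner of the small
piece anyway. -/
theorem verts_succ_eq_union (n : ℕ) : verts (n + 1) = largeVerts n ∪ smallVerts n := by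
  rw [verts_succ, largeVerts, smallVerts, Set.image_insert_eq, Set.insert_union,
    Set.insert_eq_of_mem]
  rw [largePiece_topPoint, ← smallPiece_corners.2.2.2.2.1]
  exact Or.inr ⟨_, largeHexagon_mem_verts _ _, rfl⟩

theorem finite_largeVerts (n : ℕ) : (largeVerts n).Finite := ((finite_verts n).insert _).image _

theorem finite_smallVerts (n : ℕ) : (smallVerts n).Finite := (finite_verts _).image _

theorem topPoint_mem_region : topPoint ∈ region :=
  ⟨(invPsi_pow_pos 4).le, by simp only [topPoint]; linarith [invPsi_sq_add, invPsi_pow_pos 2],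
    invPsi_pos.le, le_rfl, Or.inl (invPsi_pow_lt (by norm_num)).le⟩

theorem largeVerts_subset (n : ℕ) : largeVerts n ⊆ largeRegion := by
  rintro _ ⟨p, rfl | hp, rfl⟩
  · exact largePiece_mem topPoint_mem_region
  · exact largePiece_mem (verts_subset_region n hp)

theorem smallVerts_subset (n : ℕ) : smallVerts n ⊆ smallRegion := by
  rintro _ ⟨p, hp, rfl⟩
  exact smallPiece_mem (verts_subset_region _ hp)

/-- Parametrizations of the three segments that make up the common boundary of the two pieces. -/
noncomputable def junction (i : Fin 3) (a : ℝ) : ℝ × ℝ :=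
  ![(ψ ^ 4, ψ ^ 5 * (1 - a)), (ψ ^ 2 - ψ ^ 6 * a, ψ ^ 5), (ψ ^ 2, ψ ^ 3 - ψ ^ 7 * a)] i

theorem exists_junction {p : ℝ × ℝ} (hl : p ∈ largeRegion) (hs : p ∈ smallRegion) :
    ∃ i, ∃ a, 0 ≤ a ∧ a ≤ 1 ∧ p = junction i a := by
  obtain ⟨x, y⟩ := p
  obtain ⟨h1, h2, h3, h4, h5⟩ := hl
  obtain ⟨k1, k2, k3, k4, k5⟩ := hs
  simp only at h1 h2 h3 h4 h5 k1 k2 k3 k4 k5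
  have s5 := invPsi_pow_pos 5
  have s6 := invPsi_pow_pos 6
  have s7 := invPsi_pow_pos 7
  have e4 := invPsi_four_add
  have e5 := invPsi_five_add
  rcases h5 with h5 | h5 <;> rcases k5 with k5 | k5
  · refine ⟨2, (ψ ^ 3 - y) / ψ ^ 7, div_nonneg (by linarith) s7.le,
      (div_le_one s7).2 (by linarith), ?_⟩
    simp only [junction, Matrix.cons_val, Prod.mk.injEq]
    rw [mul_div_cancel₀ _ s7.ne']
    exact ⟨by linarith, by ring⟩
  · refine ⟨1, (ψ ^ 2 - x) / ψ ^ 6, div_nonneg (by linarith) s6.le,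
      (div_le_one s6).2 (by linarith), ?_⟩
    simp only [junction, Matrix.cons_val, Prod.mk.injEq]
    rw [mul_div_cancel₀ _ s6.ne']
    exact ⟨by ring, by linarith⟩
  · linarith
  · refine ⟨0, 1 - y / ψ ^ 5, sub_nonneg.2 ((div_le_one s5).2 k5),
      sub_le_self _ (div_nonneg h3 s5.le), ?_⟩
    simp only [junction, Matrix.cons_val, Prod.mk.injEq]
    rw [sub_sub_cancel, mul_div_cancel₀ _ s5.ne']
    exact ⟨by linarith, rfl⟩

theorem largePiece_sidePoint_two (a : ℝ) : largePiece (sidePoint 2 a) = junction 0 a := by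
  ext
  · simp [sidePoint, junction, largePiece_apply]; ring
  · simp [sidePoint, junction, largePiece_apply]; ring

theorem largePiece_sidePoint_three (a : ℝ) : largePiece (sidePoint 3 a) = junction 1 a := by
  ext
  · simp [sidePoint, junction, largePiece_apply]; ring
  · simp [sidePoint, junction, largePiece_apply]; linarith [invPsi_three_add]

theorem largePiece_sidePoint_four_mul (a : ℝ) :
    largePiece (sidePoint 4 (ψ ^ 4 * (1 - a))) = junction 2 a := by
  ext
  · simp [sidePoint, junction, largePiece_apply]; ring
  · simp [sidePoint, junction, largePiece_apply]; linarith [invPsi_three_add, invPsi_five_add]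

theorem smallPiece_sidePoint_one (a : ℝ) : smallPiece (sidePoint 1 a) = junction 0 a := by
  ext
  · simp [sidePoint, junction, smallPiece_apply]; linarith [invPsi_sq_add]
  · simp [sidePoint, junction, smallPiece_apply]; ring

theorem smallPiece_sidePoint_two (a : ℝ) : smallPiece (sidePoint 2 a) = junction 1 a := by
  ext
  · simp [sidePoint, junction, smallPiece_apply]; linarith [invPsi_sq_add, invPsi_four_add]
  · simp [sidePoint, junction, smallPiece_apply]; ring

theorem smallPiece_sidePoint_three (a : ℝ) : smallPiece (sidePoint 3 a) = junction 2 a := by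
  ext
  · simp [sidePoint, junction, smallPiece_apply]; linarith [invPsi_sq_add]
  · simp [sidePoint, junction, smallPiece_apply]; ring

theorem topPoint_ne_sidePoint_two (a : ℝ) : sidePoint 2 a ≠ topPoint := fun h => by
  have h2 : ψ ^ 3 = ψ := congrArg Prod.snd h
  linarith [invPsi_three_add, invPsi_pow_pos 5]

theorem topPoint_ne_sidePoint_three (a : ℝ) : sidePoint 3 a ≠ topPoint := fun h => by
  have h2 : ψ ^ 2 = ψ ^ 4 := congrArg Prod.fst h
  linarith [invPsi_four_add, invPsi_pow_pos 6]

theorem sidePoint_four_injective : Function.Injective (sidePoint 4) := fun a b h => by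
  have h2 : ψ ^ 2 * (1 - a) = ψ ^ 2 * (1 - b) := congrArg Prod.fst h
  exact sub_right_injective (mul_left_cancel₀ (invPsi_pow_pos 2).ne' h2)

theorem junction_mem_smallVerts (n : ℕ) (i : Fin 3) {a : ℝ} (h0 : 0 ≤ a) (h1 : a ≤ 1) :
    junction i a ∈ smallVerts n ↔ a ∈ bottom (n - (i + 4)) := by
  fin_cases i
  · change junction 0 a ∈ _ ↔ _
    rw [← smallPiece_sidePoint_one, smallVerts, smallPiece_injective.mem_set_image,
      sidePoint_one_mem_verts_iff h0 h1, Nat.sub_sub]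
  · change junction 1 a ∈ _ ↔ _
    rw [← smallPiece_sidePoint_two, smallVerts, smallPiece_injective.mem_set_image,
      sidePoint_two_mem_verts h0 h1, Nat.sub_sub]
  · change junction 2 a ∈ _ ↔ _
    rw [← smallPiece_sidePoint_three, smallVerts, smallPiece_injective.mem_set_image,
      sidePoint_three_mem_verts h0 h1, Nat.sub_sub]

/-- Seen from the large piece, the staircase consists of its sides 2 and 3 and a part of its side 4.
Seen from the small piece it consists of sides 1, 2 and 3, one step later. Both views give the
delays 4, 5, 6, which is why the tilings of the pieces match. -/
theorem junction_mem_largeVerts (n : ℕ) (i : Fin 3) {a : ℝ} (h0 : 0 ≤ a) (h1 : a ≤ 1) :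
    junction i a ∈ largeVerts n ↔ a ∈ bottom (n - (i + 4)) := by
  fin_cases i
  · change junction 0 a ∈ _ ↔ _
    rw [← largePiece_sidePoint_two, largeVerts, largePiece_injective.mem_set_image,
      Set.mem_insert_iff, or_iff_right (topPoint_ne_sidePoint_two a),
      sidePoint_two_mem_verts h0 h1]
  · change junction 1 a ∈ _ ↔ _
    rw [← largePiece_sidePoint_three, largeVerts, largePiece_injective.mem_set_image,
      Set.mem_insert_iff, or_iff_right (topPoint_ne_sidePoint_three a),
      sidePoint_three_mem_verts h0 h1]
  · change junction 2 a ∈ _ ↔ _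
    have s4 := invPsi_pow_pos 4
    have l4 : ψ ^ 4 < 1 := by linarith [invPsi_sq_add, invPsi_pow_pos 2]
    rw [← largePiece_sidePoint_four_mul, largeVerts, largePiece_injective.mem_set_image,
      Set.mem_insert_iff, sidePoint_four_mem_verts (mul_nonneg s4.le (sub_nonneg.2 h1))
        (by nlinarith), ← sidePoint_four_eq_topPoint, sidePoint_four_injective.eq_iff,
      mul_eq_left₀ s4.ne', sub_eq_self, mul_one_sub_mem_bottom_iff h0 h1, Nat.sub_sub]

theorem largeVerts_inter_smallRegion (n : ℕ) : largeVerts n ∩ smallRegion ⊆ smallVerts n := by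
  rintro p ⟨hp, hs⟩
  obtain ⟨i, a, h0, h1, rfl⟩ := exists_junction (largeVerts_subset n hp) hs
  rwa [junction_mem_smallVerts n i h0 h1, ← junction_mem_largeVerts n i h0 h1]

theorem smallVerts_inter_largeRegion (n : ℕ) : smallVerts n ∩ largeRegion ⊆ largeVerts n := by
  rintro p ⟨hp, hl⟩
  obtain ⟨i, a, h0, h1, rfl⟩ := exists_junction hl (smallVerts_subset n hp)
  rwa [junction_mem_largeVerts n i h0 h1, ← junction_mem_smallVerts n i h0 h1]

/-- The vertices on the common boundary of the two pieces. -/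
noncomputable def commonVerts (n : ℕ) : Set (ℝ × ℝ) := largeVerts n ∩ smallVerts n

theorem junction_mem_commonVerts (n : ℕ) (i : Fin 3) {a : ℝ} (h0 : 0 ≤ a) (h1 : a ≤ 1) :
    junction i a ∈ commonVerts n ↔ a ∈ bottom (n - (i + 4)) := by
  rw [commonVerts, Set.mem_inter_iff, junction_mem_largeVerts n i h0 h1,
    junction_mem_smallVerts n i h0 h1, and_self]

theorem commonVerts_eq (n : ℕ) :
    commonVerts n = junction 0 '' bottom (n - 4) ∪ junction 1 '' bottom (n - 5) ∪
      junction 2 '' bottom (n - 6) := by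
  ext p
  constructor
  · intro hp
    obtain ⟨i, a, h0, h1, rfl⟩ :=
      exists_junction (largeVerts_subset n hp.1) (smallVerts_subset n hp.2)
    rw [junction_mem_commonVerts n i h0 h1] at hp
    fin_cases i
    exacts [Or.inl (Or.inl ⟨a, hp, rfl⟩), Or.inl (Or.inr ⟨a, hp, rfl⟩), Or.inr ⟨a, hp, rfl⟩]
  · rintro ((⟨a, ha, rfl⟩ | ⟨a, ha, rfl⟩) | ⟨a, ha, rfl⟩) <;>
      have ha' := bottom_subset _ ha
    exacts [(junction_mem_commonVerts n 0 ha'.1 ha'.2).2 ha,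
      (junction_mem_commonVerts n 1 ha'.1 ha'.2).2 ha,
      (junction_mem_commonVerts n 2 ha'.1 ha'.2).2 ha]

theorem junction_injective (i : Fin 3) : Function.Injective (junction i) := by
  intro a b h
  have h1 := congrArg Prod.fst h
  have h2 := congrArg Prod.snd h
  fin_cases i <;> simpa [junction, invPsi_pos.ne'] using And.intro h1 h2

theorem ncard_commonVerts (n : ℕ) :
    (commonVerts n).ncard + 2 =
      (bottom (n - 4)).ncard + (bottom (n - 5)).ncard + (bottom (n - 6)).ncard := by
  have s6 := invPsi_pow_pos 6
  have s7 := invPsi_pow_pos 7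
  have s4 := invPsi_pow_pos 4
  have s5 := invPsi_pow_pos 5
  have e4 := invPsi_four_add
  have e5 := invPsi_five_add
  have f0 := (finite_bottom (n - 4)).image (junction 0)
  have f1 := (finite_bottom (n - 5)).image (junction 1)
  have f2 := (finite_bottom (n - 6)).image (junction 2)
  have i01 : junction 0 '' bottom (n - 4) ∩ junction 1 '' bottom (n - 5) = {(ψ ^ 4, ψ ^ 5)} := by
    ext p
    constructor
    · rintro ⟨⟨a, ha, rfl⟩, ⟨b, hb, he⟩⟩
      have h1 : ψ ^ 2 - ψ ^ 6 * b = ψ ^ 4 := congrArg Prod.fst he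
      have h2 : ψ ^ 5 = ψ ^ 5 * (1 - a) := congrArg Prod.snd he
      exact Prod.ext rfl h2.symm
    · rintro rfl
      refine ⟨⟨0, zero_mem_bottom _, ?_⟩, ⟨1, one_mem_bottom _, ?_⟩⟩
      · simp [junction]
      · simp [junction]; linarith
  have i2 : (junction 0 '' bottom (n - 4) ∪ junction 1 '' bottom (n - 5)) ∩
      junction 2 '' bottom (n - 6) = {(ψ ^ 2, ψ ^ 5)} := by
    ext p
    constructor
    · rintro ⟨⟨a, ha, rfl⟩ | ⟨a, ha, rfl⟩, ⟨b, hb, he⟩⟩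
      · have h1 : ψ ^ 2 = ψ ^ 4 := congrArg Prod.fst he
        linarith
      · have h1 : ψ ^ 2 = ψ ^ 2 - ψ ^ 6 * a := congrArg Prod.fst he
        exact Prod.ext h1.symm rfl
    · rintro rfl
      refine ⟨Or.inr ⟨0, zero_mem_bottom _, ?_⟩, ⟨1, one_mem_bottom _, ?_⟩⟩
      · simp [junction]
      · simp [junction]; linarith
  have h1 := ncard_union_add_one f0 f1 i01
  have h2 := ncard_union_add_one (f0.union f1) f2 i2
  rw [Set.ncard_image_of_injective _ (junction_injective _)] at h1 h2
  rw [Set.ncard_image_of_injective _ (junction_injective _)] at h1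
  rw [commonVerts_eq]
  omega

/-- On the top side, with delay 2, this point has parameter `ψ ^ 4`: the first cut of the bottom
side, made in one step. -/
theorem topPoint_mem_verts {n : ℕ} : topPoint ∈ verts n ↔ 3 ≤ n := by
  have s4 := invPsi_pow_pos 4
  have l4 : ψ ^ 4 < 1 := by linarith [invPsi_sq_add, invPsi_pow_pos 2]
  rw [← sidePoint_four_eq_topPoint, sidePoint_four_mem_verts s4.le l4.le]
  constructor
  · intro h
    by_contra! hn
    rw [show n - 2 = 0 by omega, mem_bottom_zero s4.le l4.le] at h
    exact h.elim s4.ne' l4.ne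
  · intro h
    obtain ⟨m, rfl⟩ := Nat.exists_eq_add_of_le' h
    simpa using mul_one_sub_mem_bottom_succ (zero_mem_bottom (m - 3))

theorem ncard_insert_topPoint (n : ℕ) :
    (insert topPoint (verts n)).ncard = (verts n).ncard + if n < 3 then 1 else 0 := by
  split_ifs with h
  · exact Set.ncard_insert_of_notMem (by rw [topPoint_mem_verts]; omega) (finite_verts n)
  · rw [Set.insert_eq_of_mem (topPoint_mem_verts.2 (by omega))]
    rfl

theorem ncard_verts_succ (n : ℕ) :
    (verts (n + 1)).ncard + (commonVerts n).ncard =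
      (verts n).ncard + (verts (n - 1)).ncard + if n < 3 then 1 else 0 := by
  rw [verts_succ_eq_union, commonVerts, Set.ncard_union_add_ncard_inter _ _ (finite_largeVerts n)
    (finite_smallVerts n), largeVerts, smallVerts,
    Set.ncard_image_of_injective _ largePiece_injective,
    Set.ncard_image_of_injective _ smallPiece_injective, ncard_insert_topPoint]
  ring

/-! ### The common boundary as a path: the shared darts. -/

theorem mem_segment_vertical {x y c d : ℝ} (h : y ∈ Set.Icc c d) :
    (x, y) ∈ segment ℝ (x, c) (x, d) := by
  rw [← Prod.image_mk_segment_right, segment_eq_Icc (h.1.trans h.2)]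
  exact ⟨y, h, rfl⟩

theorem mem_segment_horizontal {x y c d : ℝ} (h : x ∈ Set.Icc c d) :
    (x, y) ∈ segment ℝ (c, y) (d, y) := by
  rw [← Prod.image_mk_segment_left, segment_eq_Icc (h.1.trans h.2)]
  exact ⟨x, h, rfl⟩

/-- The common boundary of the two pieces of the large prototile. -/
def commonPath : Set (ℝ × ℝ) := largeRegion ∩ smallRegion

theorem segment_subset_commonPath_low :
    segment ℝ (ψ ^ 4, 0) (ψ ^ 4, ψ ^ 5) ⊆ commonPath := by
  rw [← Prod.image_mk_segment_right, segment_eq_Icc (invPsi_pow_pos 5).le]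
  rintro _ ⟨y, ⟨h0, h1⟩, rfl⟩
  have s4 := invPsi_pow_pos 4
  have l2 : ψ ^ 4 < ψ ^ 2 := invPsi_pow_lt (by norm_num)
  have l3 : ψ ^ 5 < ψ ^ 3 := invPsi_pow_lt (by norm_num)
  have e1 := invPsi_sq_add
  have e3 := invPsi_three_add
  exact ⟨⟨s4.le, l2.le, h0, by simp only; linarith, Or.inr le_rfl⟩,
    le_rfl, by simp only; linarith, h0, by simp only; linarith, Or.inr h1⟩

theorem segment_subset_commonPath_mid :
    segment ℝ (ψ ^ 4, ψ ^ 5) (ψ ^ 2, ψ ^ 5) ⊆ commonPath := by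
  have l2 : ψ ^ 4 < ψ ^ 2 := invPsi_pow_lt (by norm_num)
  rw [← Prod.image_mk_segment_left, segment_eq_Icc l2.le]
  rintro _ ⟨x, ⟨h0, h1⟩, rfl⟩
  have s4 := invPsi_pow_pos 4
  have s5 := invPsi_pow_pos 5
  have l3 : ψ ^ 5 < ψ ^ 3 := invPsi_pow_lt (by norm_num)
  have e1 := invPsi_sq_add
  have e3 := invPsi_three_add
  exact ⟨⟨s4.le.trans h0, h1, s5.le, by simp only; linarith, Or.inl le_rfl⟩,
    h0, by simp only; linarith, s5.le, l3.le, Or.inr le_rfl⟩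

theorem segment_subset_commonPath_high :
    segment ℝ (ψ ^ 2, ψ ^ 5) (ψ ^ 2, ψ ^ 3) ⊆ commonPath := by
  have l3 : ψ ^ 5 < ψ ^ 3 := invPsi_pow_lt (by norm_num)
  rw [← Prod.image_mk_segment_right, segment_eq_Icc l3.le]
  rintro _ ⟨y, ⟨h0, h1⟩, rfl⟩
  have s2 := invPsi_pow_pos 2
  have s4 := invPsi_pow_pos 4
  have s5 := invPsi_pow_pos 5
  have l2 : ψ ^ 4 < ψ ^ 2 := invPsi_pow_lt (by norm_num)
  have e1 := invPsi_sq_add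
  have e3 := invPsi_three_add
  exact ⟨⟨s2.le, le_rfl, s5.le.trans h0, by simp only; linarith, Or.inl h0⟩,
    l2.le, by simp only; linarith, s5.le.trans h0, h1, Or.inl le_rfl⟩

/-- The sum of the coordinates, which is increasing along the common boundary. -/
noncomputable def height : ℝ × ℝ →ₗ[ℝ] ℝ := LinearMap.fst ℝ ℝ ℝ + LinearMap.snd ℝ ℝ ℝ

theorem height_apply (p : ℝ × ℝ) : height p = p.1 + p.2 := rfl

theorem injOn_height : Set.InjOn height commonPath := by
  rintro ⟨x, y⟩ ⟨⟨h1, h2, h3, h4, h5⟩, k1, k2, k3, k4, k5⟩ ⟨x', y'⟩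
    ⟨⟨h1', h2', h3', h4', h5'⟩, k1', k2', k3', k4', k5'⟩ h
  simp only [height_apply] at *
  have l2 : ψ ^ 4 < ψ ^ 2 := invPsi_pow_lt (by norm_num)
  have hx : x = x' := by
    rcases h5 with h5 | h5 <;> rcases k5 with k5 | k5 <;> rcases h5' with h5' | h5' <;>
      rcases k5' with k5' | k5' <;> linarith
  rw [Prod.mk.injEq]
  exact ⟨hx, by linarith⟩

theorem mem_segment_low {p : ℝ × ℝ} (hp : p ∈ commonPath) (h : height p ≤ ψ ^ 4 + ψ ^ 5) :
    p ∈ segment ℝ (ψ ^ 4, 0) (ψ ^ 4, ψ ^ 5) := by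
  obtain ⟨x, y⟩ := p
  obtain ⟨⟨h1, h2, h3, h4, h5⟩, k1, k2, k3, k4, k5⟩ := hp
  simp only [height_apply] at *
  obtain rfl : x = ψ ^ 4 := by rcases h5 with h5 | h5 <;> linarith
  exact mem_segment_vertical ⟨h3, by linarith⟩

theorem mem_segment_mid {p : ℝ × ℝ} (hp : p ∈ commonPath) (h : ψ ^ 4 + ψ ^ 5 ≤ height p)
    (h' : height p ≤ ψ ^ 2 + ψ ^ 5) : p ∈ segment ℝ (ψ ^ 4, ψ ^ 5) (ψ ^ 2, ψ ^ 5) := by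
  obtain ⟨x, y⟩ := p
  obtain ⟨⟨h1, h2, h3, h4, h5⟩, k1, k2, k3, k4, k5⟩ := hp
  simp only [height_apply] at *
  obtain rfl : y = ψ ^ 5 := by
    rcases h5 with h5 | h5 <;> rcases k5 with k5 | k5 <;> linarith
  exact mem_segment_horizontal ⟨k1, h2⟩

theorem mem_segment_high {p : ℝ × ℝ} (hp : p ∈ commonPath) (h : ψ ^ 2 + ψ ^ 5 ≤ height p) :
    p ∈ segment ℝ (ψ ^ 2, ψ ^ 5) (ψ ^ 2, ψ ^ 3) := by
  obtain ⟨x, y⟩ := p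
  obtain ⟨⟨h1, h2, h3, h4, h5⟩, k1, k2, k3, k4, k5⟩ := hp
  simp only [height_apply] at *
  obtain rfl : x = ψ ^ 2 := by rcases k5 with k5 | k5 <;> linarith
  exact mem_segment_vertical ⟨by linarith, k4⟩

theorem commonVerts_subset (n : ℕ) : commonVerts n ⊆ commonPath :=
  fun _ hp => ⟨largeVerts_subset n hp.1, smallVerts_subset n hp.2⟩

theorem finite_commonVerts (n : ℕ) : (commonVerts n).Finite :=
  (finite_largeVerts n).inter_of_left _

theorem lower_corner_mem_commonVerts (n : ℕ) : (ψ ^ 4, ψ ^ 5) ∈ commonVerts n := by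
  have h := (junction_mem_commonVerts n 0 le_rfl zero_le_one).2 (zero_mem_bottom _)
  simpa [junction] using h

theorem upper_corner_mem_commonVerts (n : ℕ) : (ψ ^ 2, ψ ^ 5) ∈ commonVerts n := by
  have h := (junction_mem_commonVerts n 1 le_rfl zero_le_one).2 (zero_mem_bottom _)
  simpa [junction] using h

theorem mem_darts_of_consecutive {X C : Set (ℝ × ℝ)} {S : Set (Set (ℝ × ℝ))} {P Q p q : ℝ × ℝ}
    (hPQ : segment ℝ P Q ⊆ commonPath) (hCX : C ⊆ X) (hXC : X ∩ commonPath ⊆ C)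
    (hcov : CoversSegment X S P Q) (hp : p ∈ segment ℝ P Q) (hq : q ∈ segment ℝ P Q)
    (h : (p, q) ∈ consecutivePairs height C) : (p, q) ∈ darts X S := by
  obtain ⟨hpC, hqC, hlt, ho⟩ := h
  have hno : ∀ r ∈ X, r ∉ openSegment ℝ p q := fun r hr hro =>
    ho r (hXC ⟨hr, hPQ ((convex_segment P Q).segment_subset hp hq
      (openSegment_subset_segment ℝ _ _ hro))⟩) (mem_openSegment_image_lt height hlt hro)
  exact ⟨hCX hpC, hCX hqC, fun h => hlt.ne (congrArg height h), hcov p hp q hq hno, hno⟩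

theorem consecutivePairs_subset_darts {n : ℕ} {X : Set (ℝ × ℝ)} {S : Set (Set (ℝ × ℝ))}
    (hCX : commonVerts n ⊆ X) (hXC : X ∩ commonPath ⊆ commonVerts n)
    (hlow : CoversSegment X S (ψ ^ 4, 0) (ψ ^ 4, ψ ^ 5))
    (hmid : CoversSegment X S (ψ ^ 4, ψ ^ 5) (ψ ^ 2, ψ ^ 5))
    (hhigh : CoversSegment X S (ψ ^ 2, ψ ^ 5) (ψ ^ 2, ψ ^ 3)) :
    consecutivePairs height (commonVerts n) ⊆ darts X S := by
  rintro ⟨p, q⟩ h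
  have hp := commonVerts_subset n h.1
  have hq := commonVerts_subset n h.2.1
  have hlt := h.2.2.1
  have h1 := h.2.2.2 _ (lower_corner_mem_commonVerts n)
  have h2 := h.2.2.2 _ (upper_corner_mem_commonVerts n)
  simp only [height_apply (_, _), not_and_or, not_lt] at h1 h2 hlt hp hq
  rcases h1 with h1 | h1
  · rcases h2 with h2 | h2
    · exact mem_darts_of_consecutive segment_subset_commonPath_high hCX hXC hhigh
        (mem_segment_high hp h2) (mem_segment_high hq (h2.trans hlt.le)) h
    · exact mem_darts_of_consecutive segment_subset_commonPath_mid hCX hXC hmid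
        (mem_segment_mid hp h1 (hlt.le.trans h2)) (mem_segment_mid hq (h1.trans hlt.le) h2) h
  · exact mem_darts_of_consecutive segment_subset_commonPath_low hCX hXC hlow
      (mem_segment_low hp (hlt.le.trans h1)) (mem_segment_low hq h1) h

/-- Since `M` is a vertex, two points with no vertex between them cannot lie strictly on different
sides of `M`, so one of the halves contains both. -/
theorem CoversSegment.trans {X : Set (ℝ × ℝ)} {S : Set (Set (ℝ × ℝ))} {P M Q : ℝ × ℝ}
    (l : ℝ × ℝ →ₗ[ℝ] ℝ) (hl : Set.InjOn l (segment ℝ P Q)) (hlPM : l P < l M)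
    (hlMQ : l M < l Q) (hM : M ∈ segment ℝ P Q) (hMX : M ∈ X)
    (h₁ : CoversSegment X S P M) (h₂ : CoversSegment X S M Q) : CoversSegment X S P Q := by
  have hsub : ∀ u ∈ segment ℝ P Q, ∀ v ∈ segment ℝ P Q, segment ℝ u v ⊆ segment ℝ P Q :=
    fun u hu v hv => (convex_segment P Q).segment_subset hu hv
  have hP := left_mem_segment ℝ P Q
  have hQ := right_mem_segment ℝ P Q
  have bounds : ∀ r ∈ segment ℝ P Q, l P ≤ l r ∧ l r ≤ l Q := by
    intro r hr
    have h : l.toAffineMap r ∈ l.toAffineMap '' segment ℝ P Q := ⟨r, hr, rfl⟩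
    rw [image_segment] at h
    simpa [segment_eq_Icc (hlPM.trans hlMQ).le] using h
  have low : ∀ r ∈ segment ℝ P Q, l r ≤ l M → r ∈ segment ℝ P M := by
    intro r hr hrM
    have h : l r ∈ l.toAffineMap '' segment ℝ P M := by
      rw [image_segment]
      simpa [segment_eq_Icc hlPM.le] using ⟨(bounds r hr).1, hrM⟩
    obtain ⟨r', hr', he⟩ := h
    rwa [← hl (hsub _ hP _ hM hr') hr he]
  have high : ∀ r ∈ segment ℝ P Q, l M ≤ l r → r ∈ segment ℝ M Q := by
    intro r hr hrM
    have h : l r ∈ l.toAffineMap '' segment ℝ M Q := by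
      rw [image_segment]
      simpa [segment_eq_Icc hlMQ.le] using ⟨hrM, (bounds r hr).2⟩
    obtain ⟨r', hr', he⟩ := h
    rwa [← hl (hsub _ hM _ hQ hr') hr he]
  have key : ∀ p ∈ segment ℝ P Q, ∀ q ∈ segment ℝ P Q, (∀ r ∈ X, r ∉ openSegment ℝ p q) →
      ¬(l p < l M ∧ l M < l q) := by
    rintro p hp q hq ho ⟨h1, h2⟩
    obtain ⟨r, hr, he⟩ := exists_mem_openSegment_of_lt l h1 h2
    have := hl (hsub _ hp _ hq (openSegment_subset_segment ℝ _ _ hr)) hM he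
    exact ho M hMX (this ▸ hr)
  intro p hp q hq ho
  have k1 := key p hp q hq ho
  have k2 := key q hq p hp (fun r hr => openSegment_symm ℝ p q ▸ ho r hr)
  rw [not_and_or, not_lt, not_lt] at k1 k2
  rcases le_total (l p) (l M) with hpM | hpM <;> rcases le_total (l q) (l M) with hqM | hqM
  · exact h₁ p (low p hp hpM) q (low q hq hqM) ho
  · rcases k1 with k1 | k1
    · exact h₂ p (high p hp k1) q (high q hq hqM) ho
    · exact h₁ p (low p hp hpM) q (low q hq k1) ho
  · rcases k2 with k2 | k2
    · exact h₂ p (high p hp hpM) q (high q hq k2) ho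
    · exact h₁ p (low p hp k2) q (low q hq hqM) ho
  · exact h₂ p (high p hp hpM) q (high q hq hqM) ho

theorem reentrant_corner_mem_segment :
    largeHexagon 3 ∈ segment ℝ (ψ ^ 2, ψ ^ 5) (largeHexagon 4) :=
  mem_segment_vertical ⟨(invPsi_pow_lt (by norm_num)).le,
    by linarith [invPsi_three_add, invPsi_pow_pos 5]⟩

/-- After further cuts a side of the prototile need not lie in one tile side, but neighbouring
vertices on it still do. This ensures that consecutive vertices of the staircase are adjacent in
both pieces. -/
theorem coversSegment_corners (n : ℕ) (i : Fin 6) :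
    CoversSegment (verts n) (sides n) (largeHexagon i) (largeHexagon (i + 1)) := by
  induction n using Nat.strong_induction_on generalizing i with
  | _ n ih =>
    cases n with
    | zero => exact CoversSegment.of_mem (sides_zero ▸ ⟨i, rfl⟩)
    | succ n =>
      have hl := fun i => ((ih n (by omega) i).image largePiece).mono
        (Y := verts (n + 1)) (T := sides (n + 1)) (verts_succ n ▸ Set.subset_union_left)
        (sides_succ n ▸ Set.subset_union_left)
      have hs := fun i => ((ih (n - 1) (by omega) i).image smallPiece).mono
        (Y := verts (n + 1)) (T := sides (n + 1)) (verts_succ n ▸ Set.subset_union_right)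
        (sides_succ n ▸ Set.subset_union_right)
      obtain ⟨l0, l1, l2, l3, l4, l5⟩ := largePiece_corners
      obtain ⟨s0, s1, s2, s3, s4, s5⟩ := smallPiece_corners
      have hl0 := hl 0
      have hl1 := hl 1
      have hl4 := hl 4
      have hl5 := hl 5
      have hs0 := hs 0
      have hs4 := hs 4
      have hs5 := hs 5
      simp only [Fin.reduceAdd] at hl0 hl1 hl4 hl5 hs0 hs4 hs5
      rw [l0, l1] at hl0
      rw [l1, l2] at hl1
      rw [l4, l5] at hl4
      rw [l5, l0] at hl5
      rw [s0, s1] at hs0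
      rw [s4, s5] at hs4
      rw [s5, s0] at hs5
      have p4 := invPsi_pow_pos 4
      have lt4 : ψ ^ 4 < 1 := by linarith [invPsi_sq_add, invPsi_pow_pos 2]
      -- Only the bottom side is shared between both pieces and has to be joined at the cut `ψ ^ 4`;
      -- each other side lies on a single side of one piece.
      have hbottom : CoversSegment (verts (n + 1)) (sides (n + 1)) ((0 : ℝ), (0 : ℝ)) (1, 0) := by
        refine CoversSegment.trans (LinearMap.fst ℝ ℝ ℝ) (M := (ψ ^ 4, 0)) ?_ (by simpa only [LinearMap.fst_apply]) (by simpa only [LinearMap.fst_apply])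
          (mem_segment_horizontal ⟨p4.le, lt4.le⟩) ?_ hl1 hs0.symm
        · rw [← Prod.image_mk_segment_left]
          rintro _ ⟨x, -, rfl⟩ _ ⟨y, -, rfl⟩ h
          exact Prod.ext h rfl
        · rw [← l2]
          exact largePiece_mem_verts (largeHexagon_mem_verts n 2)
      fin_cases i
      exacts [hbottom, hs5.symm, hs4.symm,
        hl4.subsegment reentrant_corner_mem_segment (right_mem_segment ℝ _ _), hl5, hl0]

theorem consecutivePairs_subset_large (n : ℕ) :
    consecutivePairs height (commonVerts n) ⊆
      darts (largeVerts n) (Set.image largePiece '' sides n) := by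
  have hl := fun i => ((coversSegment_corners n i).image largePiece).mono (Y := largeVerts n)
    (Set.image_mono (Set.subset_insert _ _)) subset_rfl
  obtain ⟨l0, l1, l2, l3, l4, l5⟩ := largePiece_corners
  have h2 := hl 2
  have h3 := hl 3
  have h4 := hl 4
  simp only [Fin.reduceAdd] at h2 h3 h4
  rw [l2, l3] at h2
  rw [l3, l4] at h3
  rw [l4, l5] at h4
  exact consecutivePairs_subset_darts Set.inter_subset_left
    (fun p hp => ⟨hp.1, largeVerts_inter_smallRegion n ⟨hp.1, hp.2.2⟩⟩) h2 h3
    (h4.subsegment (left_mem_segment ℝ _ _) reentrant_corner_mem_segment)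

theorem consecutivePairs_subset_small (n : ℕ) :
    consecutivePairs height (commonVerts n) ⊆
      darts (smallVerts n) (Set.image smallPiece '' sides (n - 1)) := by
  have hs := fun i => (coversSegment_corners (n - 1) i).image smallPiece
  obtain ⟨s0, s1, s2, s3, s4, s5⟩ := smallPiece_corners
  have h1 := hs 1
  have h2 := hs 2
  have h3 := hs 3
  simp only [Fin.reduceAdd] at h1 h2 h3
  rw [s1, s2] at h1
  rw [s2, s3] at h2
  rw [s3, s4] at h3
  exact consecutivePairs_subset_darts Set.inter_subset_right
    (fun p hp => ⟨smallVerts_inter_largeRegion n ⟨hp.1, hp.2.1⟩, hp.1⟩) h1 h2 h3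

theorem large_sides_subset {n : ℕ} {t : Set (ℝ × ℝ)} (ht : t ∈ Set.image largePiece '' sides n) :
    t ⊆ largeRegion := by
  obtain ⟨t, ht, rfl⟩ := ht
  rintro _ ⟨p, hp, rfl⟩
  exact largePiece_mem (subset_region_of_mem_sides ht hp)

theorem small_sides_subset {n : ℕ} {t : Set (ℝ × ℝ)} (ht : t ∈ Set.image smallPiece '' sides n) :
    t ⊆ smallRegion := by
  obtain ⟨t, ht, rfl⟩ := ht
  rintro _ ⟨p, hp, rfl⟩
  exact smallPiece_mem (subset_region_of_mem_sides ht hp)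

/-- A dart of both pieces runs inside both regions, hence along the staircase. There `height` is
injective, so having no vertex in between means being consecutive in height. -/
theorem darts_inter (n : ℕ) :
    darts (largeVerts n) (Set.image largePiece '' sides n) ∩
        darts (smallVerts n) (Set.image smallPiece '' sides (n - 1)) =
      consecutivePairs height (commonVerts n) ∪
        Prod.swap '' consecutivePairs height (commonVerts n) := by
  ext ⟨p, q⟩
  constructor
  · rintro ⟨⟨hp, hq, hne, ⟨t, ht, hst⟩, ho⟩, hp', hq', -, ⟨t', ht', hst'⟩, -⟩
    have hpath : segment ℝ p q ⊆ commonPath := fun r hr =>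
      ⟨large_sides_subset ht (hst hr), small_sides_subset ht' (hst' hr)⟩
    have hno : ∀ r ∈ commonVerts n, ∀ u ∈ openSegment ℝ p q, height u ≠ height r := by
      intro r hr u hu he
      have := injOn_height (hpath (openSegment_subset_segment ℝ _ _ hu))
        (commonVerts_subset n hr) he
      exact ho r hr.1 (this ▸ hu)
    have hh : height p ≠ height q := fun h =>
      hne (injOn_height (hpath (left_mem_segment ℝ p q)) (hpath (right_mem_segment ℝ p q)) h)
    rcases lt_or_gt_of_ne hh with hlt | hlt
    · refine Or.inl ⟨⟨hp, hp'⟩, ⟨hq, hq'⟩, hlt, fun r hr h => ?_⟩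
      obtain ⟨u, hu, he⟩ := exists_mem_openSegment_of_lt height h.1 h.2
      exact hno r hr u hu he
    · refine Or.inr ⟨(q, p), ⟨⟨hq, hq'⟩, ⟨hp, hp'⟩, hlt, fun r hr h => ?_⟩, rfl⟩
      obtain ⟨u, hu, he⟩ := exists_mem_openSegment_of_lt height h.1 h.2
      exact hno r hr u (openSegment_symm ℝ p q ▸ hu) he
  · rintro (h | ⟨⟨p', q'⟩, h, he⟩)
    · exact ⟨consecutivePairs_subset_large n h, consecutivePairs_subset_small n h⟩
    · simp only [Prod.swap, Prod.mk.injEq] at he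
      obtain ⟨rfl, rfl⟩ := he
      exact ⟨mk_mem_darts_comm.1 (consecutivePairs_subset_large n h),
        mk_mem_darts_comm.1 (consecutivePairs_subset_small n h)⟩

/-! ### The reentrant corner in the first three steps, and the recursion for darts. -/

theorem unique_side_succ {n : ℕ} {p P Q : ℝ × ℝ}
    (h : segment ℝ P Q ∈ sides n ∧ ∀ t ∈ sides n, p ∈ t → t = segment ℝ P Q)
    (hp : largePiece p ∉ smallRegion) :
    segment ℝ (largePiece P) (largePiece Q) ∈ sides (n + 1) ∧
      ∀ t ∈ sides (n + 1), largePiece p ∈ t →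
        t = segment ℝ (largePiece P) (largePiece Q) := by
  rw [sides_succ, ← image_segment]
  refine ⟨Or.inl ⟨_, h.1, rfl⟩, ?_⟩
  rintro _ (⟨t, ht, rfl⟩ | ht) hpt
  · rw [h.2 t ht (largePiece_injective.mem_set_image.1 hpt)]
  · exact absurd (small_sides_subset ht hpt) hp

theorem unique_side_zero {p : ℝ × ℝ} (i : Fin 6)
    (h : ∀ j, j ≠ i → p ∉ segment ℝ (largeHexagon j) (largeHexagon (j + 1))) :
    segment ℝ (largeHexagon i) (largeHexagon (i + 1)) ∈ sides 0 ∧ ∀ t ∈ sides 0, p ∈ t →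
      t = segment ℝ (largeHexagon i) (largeHexagon (i + 1)) := by
  rw [sides_zero]
  refine ⟨⟨i, rfl⟩, ?_⟩
  rintro _ ⟨j, rfl⟩ hp
  by_contra hne
  exact h j (fun he => hne (he ▸ rfl)) hp

theorem unique_side_bottom :
    segment ℝ (largeHexagon 0) (largeHexagon 1) ∈ sides 0 ∧ ∀ t ∈ sides 0, (ψ ^ 4, 0) ∈ t →
      t = segment ℝ (largeHexagon 0) (largeHexagon 1) := by
  refine unique_side_zero 0 ?_
  rintro j hj ⟨a, b, ha, hb, hab, he⟩
  obtain rfl : b = 1 - a := by linarith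
  have h1 := congrArg Prod.fst he
  have h2 := congrArg Prod.snd he
  have s0 := invPsi_pos
  have s2 := invPsi_pow_pos 2
  have s3 := invPsi_pow_pos 3
  have s4 := invPsi_pow_pos 4
  have s6 := invPsi_pow_pos 6
  have e1 := invPsi_sq_add
  have e4 := invPsi_four_add
  clear he
  fin_cases j <;> simp [largeHexagon] at h1 h2 hj <;> linarith

theorem unique_side_left :
    segment ℝ (largeHexagon 5) (largeHexagon 0) ∈ sides 0 ∧ ∀ t ∈ sides 0, (0, ψ ^ 3) ∈ t →
      t = segment ℝ (largeHexagon 5) (largeHexagon 0) := by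
  refine unique_side_zero 5 ?_
  rintro j hj ⟨a, b, ha, hb, hab, he⟩
  obtain rfl : b = 1 - a := by linarith
  have h1 := congrArg Prod.fst he
  have h2 := congrArg Prod.snd he
  have s0 := invPsi_pos
  have s2 := invPsi_pow_pos 2
  have s3 := invPsi_pow_pos 3
  have s4 := invPsi_pow_pos 4
  have s5 := invPsi_pow_pos 5
  have e1 := invPsi_sq_add
  have e3 := invPsi_three_add
  have m := mul_nonneg s2.le hb
  have m' := mul_nonneg s4.le ha
  clear he
  fin_cases j <;> simp [largeHexagon] at h1 h2 hj <;> nlinarith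

theorem unique_side_top :
    segment ℝ (largeHexagon 4) (largeHexagon 5) ∈ sides 0 ∧ ∀ t ∈ sides 0, topPoint ∈ t →
      t = segment ℝ (largeHexagon 4) (largeHexagon 5) := by
  refine unique_side_zero 4 ?_
  rintro j hj ⟨a, b, ha, hb, hab, he⟩
  obtain rfl : b = 1 - a := by linarith
  have h1 := congrArg Prod.fst he
  have h2 := congrArg Prod.snd he
  have s0 := invPsi_pos
  have s2 := invPsi_pow_pos 2
  have s4 := invPsi_pow_pos 4
  have s5 := invPsi_pow_pos 5
  have s6 := invPsi_pow_pos 6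
  have e1 := invPsi_sq_add
  have e3 := invPsi_three_add
  have e4 := invPsi_four_add
  clear he
  fin_cases j <;> simp [largeHexagon, topPoint] at h1 h2 hj <;> nlinarith

theorem largePiece_left_point : largePiece (0, ψ ^ 3) = topPoint := by
  ext <;> simp [topPoint, largePiece_apply]; ring

theorem largePiece_bottom_point : largePiece (ψ ^ 4, 0) = (0, ψ ^ 3) := by
  ext <;> simp [largePiece_apply]; linarith [invPsi_three_add]

theorem topPoint_notMem_smallRegion : topPoint ∉ smallRegion := by
  rintro ⟨-, -, -, h, -⟩
  simp only [topPoint] at h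
  linarith [invPsi_three_add, invPsi_pow_pos 5]

/-- Under `largePiece` the point pulls back to `(0, ψ ^ 3)` and then to `(ψ ^ 4, 0)`, a point inside
the uncut bottom side. So for `n < 3` it lies on the undivided top side only, and inserting it
subdivides a single edge. -/
theorem unique_side_topPoint {n : ℕ} (hn : n < 3) :
    segment ℝ (largeHexagon 4) (largeHexagon 5) ∈ sides n ∧ ∀ t ∈ sides n, topPoint ∈ t →
      t = segment ℝ (largeHexagon 4) (largeHexagon 5) := by
  obtain ⟨l0, l1, -, -, -, l5⟩ := largePiece_corners
  have hl : (0, ψ ^ 3) ∉ smallRegion := fun h => (invPsi_pow_pos 4).not_ge h.1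
  interval_cases n
  · exact unique_side_top
  · have h := unique_side_succ unique_side_left
      (largePiece_left_point ▸ topPoint_notMem_smallRegion)
    rwa [l5, l0, largePiece_left_point] at h
  · have h := unique_side_succ unique_side_bottom (largePiece_bottom_point ▸ hl)
    rw [l0, l1, largePiece_bottom_point] at h
    have h := unique_side_succ h (largePiece_left_point ▸ topPoint_notMem_smallRegion)
    rwa [l5, l0, largePiece_left_point] at h

theorem ncard_darts_insert_topPoint (n : ℕ) :
    (darts (insert topPoint (verts n)) (sides n)).ncard =
      (darts (verts n) (sides n)).ncard + if n < 3 then 2 else 0 := by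
  split_ifs with h
  · have s2 := invPsi_pow_pos 2
    have s4 := invPsi_pow_pos 4
    have l4 : ψ ^ 4 < ψ ^ 2 := invPsi_pow_lt (by norm_num)
    obtain ⟨hS, hu⟩ := unique_side_topPoint h
    rw [segment_symm] at hS hu
    refine ncard_darts_insert (finite_verts n) (LinearMap.fst ℝ ℝ ℝ)
      (largeHexagon_mem_verts n 5) (largeHexagon_mem_verts n 4) s4 l4 ?_ ?_ hS hu
    · change (ψ ^ 4, ψ) ∈ openSegment ℝ (0, ψ) (ψ ^ 2, ψ)
      rw [← Prod.image_mk_openSegment_left, openSegment_eq_Ioo s2]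
      exact ⟨_, ⟨s4, l4⟩, rfl⟩
    · intro r hr hrs
      change r ∈ segment ℝ (0, ψ) (ψ ^ 2, ψ) at hrs
      rw [← Prod.image_mk_segment_left, segment_eq_Icc s2.le] at hrs
      obtain ⟨x, ⟨h0, h1⟩, rfl⟩ := hrs
      have hx : sidePoint 4 (1 - x / ψ ^ 2) = (x, ψ) := by
        simp [sidePoint, mul_div_cancel₀ _ s2.ne']
      have hb0 : 0 ≤ 1 - x / ψ ^ 2 := sub_nonneg.2 ((div_le_one s2).2 h1)
      have hb1 : 1 - x / ψ ^ 2 ≤ 1 := sub_le_self _ (div_nonneg h0 s2.le)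
      simp only at hr ⊢
      rw [← hx, sidePoint_four_mem_verts hb0 hb1, show n - 2 = 0 by omega,
        mem_bottom_zero hb0 hb1] at hr
      rw [← hx]
      rcases hr with hr | hr <;> rw [hr]
      · exact Or.inr (sidePoint_zero 4)
      · exact Or.inl (sidePoint_one 4)
  · rw [Set.insert_eq_of_mem (topPoint_mem_verts.2 (by omega))]
    rfl

/-- The shared path on `C` vertices has `2 * C - 2` darts, which gives the summand 2. The
conditional term is the edge subdivided by `topPoint`. -/
theorem ncard_darts_succ (n : ℕ) :
    (darts (verts (n + 1)) (sides (n + 1))).ncard + 2 * (commonVerts n).ncard =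
      (darts (verts n) (sides n)).ncard + (darts (verts (n - 1)) (sides (n - 1))).ncard + 2 +
        if n < 3 then 2 else 0 := by
  have h := ncard_consecutivePairs_symm (finite_commonVerts n)
    ⟨_, lower_corner_mem_commonVerts n⟩ (injOn_height.mono (commonVerts_subset n))
  rw [← darts_inter] at h
  have hu := Set.ncard_union_add_ncard_inter
    (darts (largeVerts n) (Set.image largePiece '' sides n))
    (darts (smallVerts n) (Set.image smallPiece '' sides (n - 1)))
    (finite_darts (finite_largeVerts n) _) (finite_darts (finite_smallVerts n) _)
  rw [← darts_union (K₁ := largeRegion) (K₂ := smallRegion) (fun t => large_sides_subset)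
    (fun t => small_sides_subset) (largeVerts_inter_smallRegion n)
    (smallVerts_inter_largeRegion n), ← verts_succ_eq_union, ← sides_succ] at hu
  rw [← h]
  rw [← add_assoc, hu, largeVerts, smallVerts, ncard_darts_image _ largePiece_injective,
    ncard_darts_image _ smallPiece_injective, ncard_darts_insert_topPoint]
  ring

/-! ### Initial values: the graph of one tile is a hexagonal cycle. -/

theorem eq_or_eq_of_corner_mem_segment {i j : Fin 6}
    (h : largeHexagon j ∈ segment ℝ (largeHexagon i) (largeHexagon (i + 1))) :
    j = i ∨ j = i + 1 := by
  obtain ⟨a, b, ha, hb, hab, he⟩ := h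
  obtain rfl : b = 1 - a := by linarith
  have h1 := congrArg Prod.fst he
  have h2 := congrArg Prod.snd he
  have s0 := invPsi_pos
  have s2 := invPsi_pow_pos 2
  have s3 := invPsi_pow_pos 3
  have s4 := invPsi_pow_pos 4
  have s5 := invPsi_pow_pos 5
  have e1 := invPsi_sq_add
  have e3 := invPsi_three_add
  have m := mul_nonneg s4.le ha
  have m' := mul_nonneg s5.le ha
  have n := mul_nonneg s4.le hb
  have n' := mul_nonneg s5.le hb
  clear he
  by_contra! hne
  obtain ⟨hne1, hne2⟩ := hne
  fin_cases i <;> fin_cases j <;> simp [largeHexagon] at h1 h2 hne1 hne2 <;> linarith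

theorem largeHexagon_injective : Function.Injective largeHexagon := by
  intro i j h
  have h1 := eq_or_eq_of_corner_mem_segment (i := i) (j := j) (h ▸ left_mem_segment ℝ _ _)
  have h2 := eq_or_eq_of_corner_mem_segment (i := j) (j := i) (h ▸ left_mem_segment ℝ _ _)
  omega

theorem ncard_verts_zero : (verts 0).ncard = 6 := by
  rw [verts_zero, ← Set.image_univ, Set.ncard_image_of_injective _ largeHexagon_injective,
    Set.ncard_univ, Nat.card_fin]

theorem darts_zero :
    darts (verts 0) (sides 0) =
      Set.range (fun i => (largeHexagon i, largeHexagon (i + 1))) ∪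
        Set.range (fun i => (largeHexagon (i + 1), largeHexagon i)) := by
  have hmem : ∀ i, (largeHexagon i, largeHexagon (i + 1)) ∈ darts (verts 0) (sides 0) := by
    intro i
    have hne : largeHexagon i ≠ largeHexagon (i + 1) := fun h => by
      have := largeHexagon_injective h
      omega
    refine ⟨largeHexagon_mem_verts 0 i, largeHexagon_mem_verts 0 (i + 1), hne,
      ⟨_, sides_zero ▸ ⟨i, rfl⟩, subset_rfl⟩, fun r hr hro => ?_⟩
    rw [verts_zero] at hr
    obtain ⟨j, rfl⟩ := hr
    rcases eq_or_eq_of_corner_mem_segment (openSegment_subset_segment ℝ _ _ hro) with rfl | rfl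
    · exact hne (left_mem_openSegment_iff.1 hro)
    · exact hne (right_mem_openSegment_iff.1 hro)
  ext ⟨p, q⟩
  constructor
  · rintro ⟨hp, hq, hne, ⟨t, ht, hst⟩, -⟩
    rw [verts_zero] at hp hq
    rw [sides_zero] at ht
    obtain ⟨i, rfl⟩ := ht
    obtain ⟨j, rfl⟩ := hp
    obtain ⟨k, rfl⟩ := hq
    rcases eq_or_eq_of_corner_mem_segment (hst (left_mem_segment ℝ _ _)) with rfl | rfl <;>
      rcases eq_or_eq_of_corner_mem_segment (hst (right_mem_segment ℝ _ _)) with rfl | rfl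
    exacts [absurd rfl hne, Or.inl ⟨j, rfl⟩, Or.inr ⟨k, rfl⟩, absurd rfl hne]
  · rintro (⟨i, h⟩ | ⟨i, h⟩) <;> rw [← h]
    exacts [hmem i, mk_mem_darts_comm.1 (hmem i)]

theorem ncard_darts_zero : (darts (verts 0) (sides 0)).ncard = 12 := by
  have hinj : Function.Injective fun i => (largeHexagon i, largeHexagon (i + 1)) :=
    fun i j h => largeHexagon_injective (congrArg Prod.fst h)
  have hinj' : Function.Injective fun i => (largeHexagon (i + 1), largeHexagon i) :=
    fun i j h => largeHexagon_injective (congrArg Prod.snd h)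
  rw [darts_zero, Set.ncard_union_eq, ← Set.image_univ, ← Set.image_univ,
    Set.ncard_image_of_injective _ hinj, Set.ncard_image_of_injective _ hinj', Set.ncard_univ,
    Nat.card_fin]
  rw [Set.disjoint_left]
  rintro _ ⟨i, rfl⟩ ⟨j, h⟩
  simp only [Prod.mk.injEq] at h
  have h1 := largeHexagon_injective h.1
  have h2 := largeHexagon_injective h.2
  omega

/-! ### Solving the two recursions. -/

/-- The contribution of the boundary to the number of vertices, less one, of the dissection of
index `j + 5`. -/
def boundaryTerm (j : ℕ) : ℕ :=
  if Even j then 2 * Nat.fib (j / 2 + 4) + Nat.fib (j / 2 + 3)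
  else Nat.fib (j / 2 + 2) + Nat.fib (j / 2 + 5) + 2 * Nat.fib (j / 2 + 3)

theorem boundaryTerm_even (m : ℕ) :
    boundaryTerm (2 * m) = 2 * Nat.fib (m + 4) + Nat.fib (m + 3) := by
  simp [boundaryTerm]

theorem boundaryTerm_odd (m : ℕ) :
    boundaryTerm (2 * m + 1) = Nat.fib (m + 2) + Nat.fib (m + 5) + 2 * Nat.fib (m + 3) := by
  rw [boundaryTerm, if_neg (by simp), show (2 * m + 1) / 2 = m by omega]

theorem boundaryTerm_add_four (j : ℕ) :
    boundaryTerm (j + 4) = boundaryTerm (j + 2) + boundaryTerm j := by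
  rcases Nat.even_or_odd' j with ⟨m, rfl | rfl⟩
  · rw [show 2 * m + 4 = 2 * (m + 2) by ring, show 2 * m + 2 = 2 * (m + 1) by ring]
    simp only [boundaryTerm_even, Nat.fib_add_two]
    ring
  · rw [show 2 * m + 1 + 4 = 2 * (m + 2) + 1 by ring, show 2 * m + 1 + 2 = 2 * (m + 1) + 1 by ring]
    simp only [boundaryTerm_odd, Nat.fib_add_two]
    ring

/-- This says that `1 + boundaryTerm` solves the inhomogeneous recursion for the vertices; twice
`boundaryTerm` then solves the one for the darts. -/
theorem ncard_commonVerts_add_boundaryTerm (j : ℕ) :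
    (commonVerts (j + 6)).ncard + boundaryTerm (j + 2) =
      boundaryTerm (j + 1) + boundaryTerm j + 1 := by
  have h := ncard_commonVerts (j + 6)
  simp only [ncard_bottom] at h
  rcases Nat.even_or_odd' j with ⟨m, rfl | rfl⟩
  · rw [show (2 * m + 6 - 4 + 1) / 2 = m + 1 by omega, show (2 * m + 6 - 5 + 1) / 2 = m + 1 by omega,
      show (2 * m + 6 - 6 + 1) / 2 = m by omega] at h
    rw [show 2 * m + 2 = 2 * (m + 1) by ring]
    simp only [boundaryTerm_even, boundaryTerm_odd, Nat.fib_add_two] at h ⊢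
    omega
  · rw [show (2 * m + 1 + 6 - 4 + 1) / 2 = m + 2 by omega,
      show (2 * m + 1 + 6 - 5 + 1) / 2 = m + 1 by omega,
      show (2 * m + 1 + 6 - 6 + 1) / 2 = m + 1 by omega] at h
    rw [show 2 * m + 1 + 2 = 2 * (m + 1) + 1 by ring, show 2 * m + 1 + 1 = 2 * (m + 1) by ring]
    simp only [boundaryTerm_even, boundaryTerm_odd, Nat.fib_add_two] at h ⊢
    omega

theorem ncard_commonVerts_small :
    (commonVerts 0).ncard = 4 ∧ (commonVerts 1).ncard = 4 ∧ (commonVerts 2).ncard = 4 ∧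
      (commonVerts 3).ncard = 4 ∧ (commonVerts 4).ncard = 4 ∧ (commonVerts 5).ncard = 5 := by
  have h0 := ncard_commonVerts 0
  have h1 := ncard_commonVerts 1
  have h2 := ncard_commonVerts 2
  have h3 := ncard_commonVerts 3
  have h4 := ncard_commonVerts 4
  have h5 := ncard_commonVerts 5
  have f2 : Nat.fib 2 = 1 := rfl
  have f3 : Nat.fib 3 = 2 := rfl
  simp only [ncard_bottom, Nat.reduceSub, Nat.reduceAdd, Nat.reduceDiv, zero_tsub, f2, f3,
    zero_add] at h0 h1 h2 h3 h4 h5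
  omega

/-- What remains after `1 + boundaryTerm j` obeys the Fibonacci recursion. The coefficients 31 and
19 fit the counts 40 and 61 at indices 5 and 6, computed upwards from the 6 corners of one tile. -/
theorem ncard_verts_add_five (j : ℕ) :
    (verts (j + 5)).ncard = 1 + boundaryTerm j + (31 * Nat.fib (j + 1) + 19 * Nat.fib j) := by
  obtain ⟨c0, c1, c2, c3, c4, c5⟩ := ncard_commonVerts_small
  have h0 := ncard_verts_succ 0
  have h1 := ncard_verts_succ 1
  have h2 := ncard_verts_succ 2
  have h3 := ncard_verts_succ 3
  have h4 := ncard_verts_succ 4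
  have h5 := ncard_verts_succ 5
  norm_num [c0, c1, c2, c3, c4, c5, ncard_verts_zero] at h0 h1 h2 h3 h4 h5
  induction j using Nat.twoStepInduction with
  | zero => simp [boundaryTerm, Nat.fib_add_two]; omega
  | one => simp [boundaryTerm, Nat.fib_add_two]; omega
  | more j ih1 ih2 =>
    have h := ncard_verts_succ (j + 6)
    have hc := ncard_commonVerts_add_boundaryTerm j
    rw [if_neg (by omega)] at h
    change (verts (j + 2 + 5)).ncard + _ = (verts (j + 1 + 5)).ncard + (verts (j + 5)).ncard + 0 at h
    have f1 : Nat.fib (j + 2 + 1) = Nat.fib (j + 1) + Nat.fib (j + 2) := Nat.fib_add_two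
    have f2 : Nat.fib (j + 2) = Nat.fib j + Nat.fib (j + 1) := Nat.fib_add_two
    rw [show j + 1 + 1 = j + 2 by ring] at ih2
    omega

/-- As for the vertices; 88 and 54 fit the counts 104 and 162 at indices 5 and 6, computed from the
12 darts of one hexagon. -/
theorem ncard_darts_add_five (j : ℕ) :
    (darts (verts (j + 5)) (sides (j + 5))).ncard =
      2 * boundaryTerm j + (88 * Nat.fib (j + 1) + 54 * Nat.fib j) := by
  obtain ⟨c0, c1, c2, c3, c4, c5⟩ := ncard_commonVerts_small
  have h0 := ncard_darts_succ 0
  have h1 := ncard_darts_succ 1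
  have h2 := ncard_darts_succ 2
  have h3 := ncard_darts_succ 3
  have h4 := ncard_darts_succ 4
  have h5 := ncard_darts_succ 5
  norm_num [c0, c1, c2, c3, c4, c5, ncard_darts_zero] at h0 h1 h2 h3 h4 h5
  induction j using Nat.twoStepInduction with
  | zero => simp [boundaryTerm, Nat.fib_add_two]; omega
  | one => simp [boundaryTerm, Nat.fib_add_two]; omega
  | more j ih1 ih2 =>
    have h := ncard_darts_succ (j + 6)
    have hc := ncard_commonVerts_add_boundaryTerm j
    rw [if_neg (by omega)] at h
    change (darts (verts (j + 2 + 5)) (sides (j + 2 + 5))).ncard + _ =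
      (darts (verts (j + 1 + 5)) (sides (j + 1 + 5))).ncard +
        (darts (verts (j + 5)) (sides (j + 5))).ncard + 2 + 0 at h
    have f1 : Nat.fib (j + 2 + 1) = Nat.fib (j + 1) + Nat.fib (j + 2) := Nat.fib_add_two
    have f2 : Nat.fib (j + 2) = Nat.fib j + Nat.fib (j + 1) := Nat.fib_add_two
    rw [show j + 1 + 1 = j + 2 by ring] at ih2
    omega

theorem linear_fib_eq (x y : ℝ) (j : ℕ) :
    x * Nat.fib (j + 1) + y * Nat.fib j =
      (x / 2 + (x / 2 + y) / Real.sqrt 5) * ((1 + Real.sqrt 5) / 2) ^ j +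
        (x / 2 - (x / 2 + y) / Real.sqrt 5) * ((1 - Real.sqrt 5) / 2) ^ j := by
  have h5 : Real.sqrt 5 ≠ 0 := by positivity
  have h := Real.coe_fib_eq j
  have h' := Real.coe_fib_eq (j + 1)
  rw [Real.goldenRatio, Real.goldenConj] at h h'
  rw [h, h', pow_succ, pow_succ]
  field_simp
  ring

theorem vertex_constants (j : ℕ) :
    (31 / 2 + 69 / (2 * Real.sqrt 5)) * ((1 + Real.sqrt 5) / 2) ^ j +
        (31 / 2 - 69 / (2 * Real.sqrt 5)) * ((1 - Real.sqrt 5) / 2) ^ j =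
      31 * Nat.fib (j + 1) + 19 * Nat.fib j := by
  rw [linear_fib_eq 31 19 j, ← div_div]
  norm_num

theorem degree_constants (j : ℕ) :
    (44 + 98 / Real.sqrt 5) * ((1 + Real.sqrt 5) / 2) ^ j +
        (44 - 98 / Real.sqrt 5) * ((1 - Real.sqrt 5) / 2) ^ j =
      88 * Nat.fib (j + 1) + 54 * Nat.fib j := by
  rw [linear_fib_eq 88 54 j]
  norm_num

theorem a2V_add_seven (j : ℕ) :
    (a2V (j + 7) : ℝ) = 1 + boundaryTerm j +
      ((31 / 2 + 69 / (2 * Real.sqrt 5)) * ((1 + Real.sqrt 5) / 2) ^ j +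
        (31 / 2 - 69 / (2 * Real.sqrt 5)) * ((1 - Real.sqrt 5) / 2) ^ j) := by
  rw [vertex_constants, a2V_add_two (j + 5), ncard_verts_add_five]
  push_cast
  ring

theorem a2T_add_seven (j : ℕ) :
    (a2T (j + 7) : ℝ) = 2 * boundaryTerm j +
      ((44 + 98 / Real.sqrt 5) * ((1 + Real.sqrt 5) / 2) ^ j +
        (44 - 98 / Real.sqrt 5) * ((1 - Real.sqrt 5) / 2) ^ j) := by
  rw [degree_constants, a2T_add_two (j + 5), ncard_darts_add_five]
  push_cast
  ring

/-! ### Asymptotics and the numerical value of the limit. -/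

/-- Any rate below the golden ratio would do. For `3 / 2` the induction closes because `1 + (3 / 2)
^ 2 ≤ (3 / 2) ^ 4`, and the factor 10 covers the four initial values. -/
theorem boundaryTerm_le (j : ℕ) : (boundaryTerm j : ℝ) ≤ 10 * (3 / 2) ^ j := by
  induction j using Nat.strong_induction_on with
  | _ j ih =>
    rcases Nat.lt_or_ge j 4 with hj | hj
    · interval_cases j <;> norm_num [boundaryTerm, Nat.fib_add_two, Nat.even_iff]
    · obtain ⟨i, rfl⟩ := Nat.exists_eq_add_of_le' hj
      have h1 := ih i (by omega)
      have h2 := ih (i + 2) (by omega)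
      have h3 : (0 : ℝ) < (3 / 2) ^ i := by positivity
      rw [boundaryTerm_add_four]
      push_cast
      rw [pow_add] at h2 ⊢
      linarith

theorem three_halves_lt : 3 / 2 < (1 + Real.sqrt 5) / 2 := by
  have : 2 < Real.sqrt 5 := Real.lt_sqrt_of_sq_lt (by norm_num)
  linarith

theorem tendsto_boundaryTerm_div :
    Tendsto (fun j => (boundaryTerm j : ℝ) / ((1 + Real.sqrt 5) / 2) ^ j) atTop (𝓝 0) := by
  have hφ : 0 < (1 + Real.sqrt 5) / 2 := by positivity
  have h : Tendsto (fun j : ℕ => 10 * ((3 / 2) / ((1 + Real.sqrt 5) / 2)) ^ j) atTop (𝓝 (10 * 0)) :=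
    (tendsto_pow_atTop_nhds_zero_of_lt_one (by positivity)
      ((div_lt_one hφ).2 three_halves_lt)).const_mul 10
  rw [mul_zero] at h
  refine squeeze_zero (fun j => by positivity) (fun j => ?_) h
  rw [div_pow (3 / 2 : ℝ), ← mul_div_assoc]
  gcongr
  exact boundaryTerm_le j

theorem tendsto_conj_div :
    Tendsto (fun j : ℕ => ((1 - Real.sqrt 5) / 2) ^ j / ((1 + Real.sqrt 5) / 2) ^ j) atTop
      (𝓝 0) := by
  have hφ : 0 < (1 + Real.sqrt 5) / 2 := by positivity
  have h5 : 0 < Real.sqrt 5 := by positivity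
  simp only [← div_pow]
  refine tendsto_pow_atTop_nhds_zero_of_abs_lt_one ?_
  rw [abs_lt, lt_div_iff₀ hφ, div_lt_iff₀ hφ]
  constructor <;> linarith

theorem tendsto_one_div_pow :
    Tendsto (fun j : ℕ => 1 / ((1 + Real.sqrt 5) / 2) ^ j) atTop (𝓝 0) := by
  have hφ := three_halves_lt
  simp only [← one_div_pow]
  exact tendsto_pow_atTop_nhds_zero_of_lt_one (by positivity)
    ((div_lt_one (by positivity)).2 (by linarith))

theorem tendsto_a2V_div :
    Tendsto (fun j : ℕ => (a2V (j + 7) : ℝ) / ((1 + Real.sqrt 5) / 2) ^ j) atTop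
      (𝓝 (31 / 2 + 69 / (2 * Real.sqrt 5))) := by
  have h := ((tendsto_one_div_pow.add tendsto_boundaryTerm_div).add_const
    (31 / 2 + 69 / (2 * Real.sqrt 5))).add
      (tendsto_conj_div.const_mul (31 / 2 - 69 / (2 * Real.sqrt 5)))
  simp only [zero_add, mul_zero, add_zero] at h
  refine h.congr fun j => ?_
  have hφ : ((1 + Real.sqrt 5) / 2) ^ j ≠ 0 := by positivity
  rw [a2V_add_seven, eq_div_iff hφ, add_mul, add_mul, add_mul, div_mul_cancel₀ _ hφ,
    div_mul_cancel₀ _ hφ, mul_assoc, div_mul_cancel₀ _ hφ]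
  ring

theorem tendsto_a2T_div :
    Tendsto (fun j : ℕ => (a2T (j + 7) : ℝ) / ((1 + Real.sqrt 5) / 2) ^ j) atTop
      (𝓝 (44 + 98 / Real.sqrt 5)) := by
  have h := ((tendsto_boundaryTerm_div.const_mul 2).add_const (44 + 98 / Real.sqrt 5)).add
      (tendsto_conj_div.const_mul (44 - 98 / Real.sqrt 5))
  simp only [zero_add, mul_zero, add_zero] at h
  refine h.congr fun j => ?_
  have hφ : ((1 + Real.sqrt 5) / 2) ^ j ≠ 0 := by positivity
  rw [a2T_add_seven, eq_div_iff hφ, add_mul, add_mul, mul_assoc, div_mul_cancel₀ _ hφ,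
    mul_assoc, div_mul_cancel₀ _ hφ]
  ring

theorem tendsto_a2T_div_a2V :
    Tendsto (fun k : ℕ => (a2T k : ℝ) / (a2V k : ℝ)) atTop
      (𝓝 ((44 + 98 / Real.sqrt 5) / (31 / 2 + 69 / (2 * Real.sqrt 5)))) := by
  rw [← tendsto_add_atTop_iff_nat 7]
  refine (tendsto_a2T_div.div tendsto_a2V_div (by positivity)).congr fun j => ?_
  have hφ : ((1 + Real.sqrt 5) / 2) ^ j ≠ 0 := by positivity
  exact div_div_div_cancel_right₀ hφ _ _

theorem limit_eq :
    (44 + 98 / Real.sqrt 5) / (31 / 2 + 69 / (2 * Real.sqrt 5)) = (29 + Real.sqrt 5) / 11 := by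
  have h5 : Real.sqrt 5 ^ 2 = 5 := Real.sq_sqrt (by norm_num)
  have h0 : 0 < Real.sqrt 5 := by positivity
  rw [div_eq_div_iff (by positivity) (by norm_num)]
  field_simp
  nlinarith

theorem abs_limit_sub_lt :
    |(44 + 98 / Real.sqrt 5) / (31 / 2 + 69 / (2 * Real.sqrt 5)) - 2.8396425434090715|
      < (1 : ℝ) / 10 ^ 15 := by
  -- By `limit_eq` the error in `√5` enters divided by 11, so these bounds are sharp enough.
  have h1 : 2.236067977499789 < Real.sqrt 5 := Real.lt_sqrt_of_sq_lt (by norm_num)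
  have h2 : Real.sqrt 5 < 2.23606797749979 := (Real.sqrt_lt' (by norm_num)).2 (by norm_num)
  rw [limit_eq, abs_lt]
  constructor <;> norm_num at h1 h2 ⊢ <;> linarith

/-! ### The closed formulas in terms of `k`. -/

theorem a2_counts_of_even {k : ℕ} (hk : 7 ≤ k) (he : Even k) :
    (a2V k : ℝ) =
        1 + (Nat.fib (k / 2) : ℝ) / 2 + Nat.fib (k / 2 + 1) + 2 * Nat.fib (k / 2 - 1)
          - (Nat.fib (k / 2 - 3) : ℝ) / 2
          + (31 / 2 + 69 / (2 * Real.sqrt 5)) * ((1 + Real.sqrt 5) / 2) ^ (k - 7)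
          + (31 / 2 - 69 / (2 * Real.sqrt 5)) * ((1 - Real.sqrt 5) / 2) ^ (k - 7) ∧
    (a2T k : ℝ) =
        Nat.fib (k / 2) + 2 * Nat.fib (k / 2 + 1) + 4 * Nat.fib (k / 2 - 1)
          - Nat.fib (k / 2 - 3)
          + (44 + 98 / Real.sqrt 5) * ((1 + Real.sqrt 5) / 2) ^ (k - 7)
          + (44 - 98 / Real.sqrt 5) * ((1 - Real.sqrt 5) / 2) ^ (k - 7) := by
  obtain ⟨m, rfl⟩ : ∃ m, k = 2 * m + 1 + 7 := by
    obtain ⟨l, rfl⟩ := he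
    exact ⟨l - 4, by omega⟩
  -- With `k / 2 = m + 4`, this merges the two halved Fibonacci numbers of the formula into `Nat.fib
  -- (m + 2)`, the first term of `boundaryTerm_odd`.
  have f4 : Nat.fib (m + 4) = 2 * Nat.fib (m + 2) + Nat.fib (m + 1) := by
    simp only [Nat.fib_add_two]; ring
  rw [a2V_add_seven, a2T_add_seven, boundaryTerm_odd, show (2 * m + 1 + 7) / 2 = m + 4 by omega,
    Nat.add_sub_cancel, show m + 4 - 1 = m + 3 by omega, show m + 4 - 3 = m + 1 by omega,
    show m + 4 + 1 = m + 5 by omega, f4]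
  push_cast
  constructor <;> ring

theorem a2_counts_of_odd {k : ℕ} (hk : 7 ≤ k) (ho : Odd k) :
    (a2V k : ℝ) =
        1 + 2 * Nat.fib ((k + 1) / 2) + Nat.fib ((k - 1) / 2)
          + (31 / 2 + 69 / (2 * Real.sqrt 5)) * ((1 + Real.sqrt 5) / 2) ^ (k - 7)
          + (31 / 2 - 69 / (2 * Real.sqrt 5)) * ((1 - Real.sqrt 5) / 2) ^ (k - 7) ∧
    (a2T k : ℝ) =
        4 * Nat.fib ((k + 1) / 2) + 2 * Nat.fib ((k - 1) / 2)
          + (44 + 98 / Real.sqrt 5) * ((1 + Real.sqrt 5) / 2) ^ (k - 7)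
          + (44 - 98 / Real.sqrt 5) * ((1 - Real.sqrt 5) / 2) ^ (k - 7) := by
  obtain ⟨m, rfl⟩ : ∃ m, k = 2 * m + 7 := by
    obtain ⟨l, rfl⟩ := ho
    exact ⟨l - 3, by omega⟩
  rw [a2V_add_seven, a2T_add_seven, boundaryTerm_even, show (2 * m + 7 + 1) / 2 = m + 4 by omega,
    Nat.add_sub_cancel, show (2 * m + 7 - 1) / 2 = m + 3 by omega]
  push_cast
  constructor <;> ring

theorem theorem3p1 :
    (∀ k : ℕ, 7 ≤ k →
      (Even k →
        (a2V k : ℝ) =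
            1 + (Nat.fib (k / 2) : ℝ) / 2 + Nat.fib (k / 2 + 1) + 2 * Nat.fib (k / 2 - 1)
              - (Nat.fib (k / 2 - 3) : ℝ) / 2
              + (31 / 2 + 69 / (2 * Real.sqrt 5)) * ((1 + Real.sqrt 5) / 2) ^ (k - 7)
              + (31 / 2 - 69 / (2 * Real.sqrt 5)) * ((1 - Real.sqrt 5) / 2) ^ (k - 7) ∧
        (a2T k : ℝ) =
            Nat.fib (k / 2) + 2 * Nat.fib (k / 2 + 1) + 4 * Nat.fib (k / 2 - 1)
              - Nat.fib (k / 2 - 3)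
              + (44 + 98 / Real.sqrt 5) * ((1 + Real.sqrt 5) / 2) ^ (k - 7)
              + (44 - 98 / Real.sqrt 5) * ((1 - Real.sqrt 5) / 2) ^ (k - 7)) ∧
      (Odd k →
        (a2V k : ℝ) =
            1 + 2 * Nat.fib ((k + 1) / 2) + Nat.fib ((k - 1) / 2)
              + (31 / 2 + 69 / (2 * Real.sqrt 5)) * ((1 + Real.sqrt 5) / 2) ^ (k - 7)
              + (31 / 2 - 69 / (2 * Real.sqrt 5)) * ((1 - Real.sqrt 5) / 2) ^ (k - 7) ∧
        (a2T k : ℝ) =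
            4 * Nat.fib ((k + 1) / 2) + 2 * Nat.fib ((k - 1) / 2)
              + (44 + 98 / Real.sqrt 5) * ((1 + Real.sqrt 5) / 2) ^ (k - 7)
              + (44 - 98 / Real.sqrt 5) * ((1 - Real.sqrt 5) / 2) ^ (k - 7))) ∧
    (∀ k : ℕ, 1 ≤ k → averageDegree (a2Graph k) = (a2T k : ℝ) / (a2V k : ℝ)) ∧
    Tendsto (fun k : ℕ => (a2T k : ℝ) / (a2V k : ℝ)) atTop
      (𝓝 ((44 + 98 / Real.sqrt 5) / (31 / 2 + 69 / (2 * Real.sqrt 5)))) ∧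
    |(44 + 98 / Real.sqrt 5) / (31 / 2 + 69 / (2 * Real.sqrt 5)) - 2.8396425434090715|
      < (1 : ℝ) / 10 ^ 15 := by
  exact ⟨fun k hk => ⟨a2_counts_of_even hk, a2_counts_of_odd hk⟩, fun _ _ => rfl,
    tendsto_a2T_div_a2V, abs_limit_sub_lt⟩
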